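/- **Theorem.** Let $N=2^n$ and let $s\ge 1$ be an integer. For complex arrays, $\|\cdot\|_1$ and $\|\cdot\|_2$ are the entrywise $\ell_1$ and $\ell_2$ norms, and $V_s$ denotes an array $V$ with all but $s$ of its largest-magnitude entries set to zero. A linear operator $T$ on a space of complex arrays has the restricted isometry property (RIP) of order $k$ and level $\delta\in(0,1)$ if $(1-\delta)\|Z\|_2^2\le\|T(Z)\|_2^2\le(1+\delta)\|Z\|_2^2$ for all arrays $Z$ with at most $k$ nonzero entries. For $X\in\mathbb{C}^{N\times N}$ the discrete gradient $\nabla X\in\mathbb{C}^{N\times N\times 2}$ has the entries $X_{j+1,k}-X_{j,k}$ and $X_{j,k+1}-X_{j,k}$ (replaced by $0$ for $j=N$, respectively $k=N$), and $\|X\|_{TV}=\|\nabla X\|_1$. Let $\mathcal{H}$ be the discrete bivariate Haar transform, that is, the map sending $X$ to its coefficients in the orthonormal basis of $\mathbb{C}^{N\times N}$ given by the constant image and the images with values $N^{-1}H\big(\tfrac{p-1}{N},\tfrac{q-1}{N}\big)$ at the pixels $(p,q)$, for $H(u,v)=2^jH^{e_1}(2^ju-k_1)H^{e_2}(2^jv-k_2)$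 with $0\le j<n$, $(e_1,e_2)\in\{0,1\}^2\setminus\{(0,0)\}$, $k\in\{0,\dots,2^j-1\}^2$, where $H^0=\mathbf 1_{[0,1)}$ and $H^1=\mathbf 1_{[0,1/2)}-\mathbf 1_{[1/2,1)}$. Let $\mathcal{A},\mathcal{A}':\mathbb{C}^{(N-1)\times N}\to\mathbb{C}^{m_1}$ be linear operators such that the concatenated operator $(U,V)\mapsto(\mathcal{A}(U),\mathcal{A}'(V))$ has the RIP of order $5s$ and some level $\delta<1/3$ (this holds in particular if $(U,V)\mapsto\mathcal{A}(U)+\mathcal{A}'(V)$ has it), and let $\mathcal{B}:\mathbb{C}^{N\times N}\to\mathbb{C}^{m_2}$ be a linear operator such that $\mathcal{B}\mathcal{H}^{-1}$ has the RIP of order $2s$ and level $\delta'<1$. If $\mathcal{A}(Z)_j=\langle Z,A_j\rangle$ with $\langle Z,W\rangle=\operatorname{trace}(ZW^*)$, let $\mathcal{A}^0(X)_j=\langle X,A_j^0\rangle$ and $\mathcal{A}_0(X)_j=\langle X,(A_j)_0\rangle$ for $X\in\mathbb{C}^{N\times N}$, where $\Phi^0$ and $\Phi_0$ denote the matrix $\Phi$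 with a row of zeros added at the top and at the bottom, respectively; likewise for $\mathcal{A}'$. Put $$\mathcal{M}(X)=\big(\mathcal{A}^0(X),\ \mathcal{A}_0(X),\ \mathcal{A}'^0(X^T),\ \mathcal{A}'_0(X^T),\ \mathcal{B}(X)\big)\in\mathbb{C}^{4m_1+m_2}.$$ Let $X\in\mathbb{C}^{N\times N}$, let $y=\mathcal{M}(X)+\xi$ with $\|\xi\|_2\le\varepsilon$, and let $\hat X$ be any minimizer of $\|Z\|_{TV}$ among all $Z\in\mathbb{C}^{N\times N}$ with $\|\mathcal{M}(Z)-y\|_2\le\varepsilon$. Then $$\|\nabla X-\nabla\hat X\|_2\le C_0\Big(\frac{\|\nabla X-(\nabla X)_s\|_1}{\sqrt s}+\varepsilon\Big),\qquad \|X-\hat X\|_{TV}\le C_0\big(\|\nabla X-(\nabla X)_s\|_1+\sqrt s\,\varepsilon\big),$$ and, if moreover $2s\le N^2$, $$\|X-\hat X\|_2\le C_1\log(N^2/s)\Big(\frac{\|\nabla X-(\nabla X)_s\|_1}{\sqrt s}+\varepsilon\Big).$$ Here $C_0>0$ is an absolute constant, and $C_1>0$ depends only on $\delta'$. -/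

import Mathlib

open scoped BigOperators

namespace TVRecovery

/-- `a × b` complex images, as vectors indexed by the pixels (rows and columns counted from `0`). -/
abbrev Img (a b : ℕ) : Type := Fin a × Fin b → ℂ

section Norms

variable {ι κ : Type*} [Fintype ι] [Fintype κ]

/-- The entrywise `ℓ₁` norm. -/
noncomputable def l1norm (x : ι → ℂ) : ℝ := ∑ i, ‖x i‖

/-- The entrywise `ℓ₂` norm (the Frobenius norm for images). -/
noncomputable def l2norm (x : ι → ℂ) : ℝ := Real.sqrt (∑ i, ‖x i‖ ^ 2)

/-- The image inner product `⟨X, Y⟩ = trace (X Y^*)`, linear in the first argument. -/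
noncomputable def imgInner (X Y : ι → ℂ) : ℂ := ∑ i, X i * star (Y i)

/-- `x` has at most `s` nonzero entries. -/
def IsSparse (s : ℕ) (x : ι → ℂ) : Prop := (Function.support x).ncard ≤ s

/-- The restricted isometry property of order `s` and level `δ ∈ (0,1)`. -/
def HasRIP (s : ℕ) (δ : ℝ) (T : (ι → ℂ) →ₗ[ℂ] (κ → ℂ)) : Prop :=
  0 < δ ∧ δ < 1 ∧ ∀ x : ι → ℂ, IsSparse s x →
    (1 - δ) * l2norm x ^ 2 ≤ l2norm (T x) ^ 2 ∧
      l2norm (T x) ^ 2 ≤ (1 + δ) * l2norm x ^ 2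

/-- `z` is `x_s`: it keeps `s` entries of `x` of largest magnitude (all of them if there are fewer
than `s`) and is zero elsewhere.  Ties may be broken in any way. -/
def IsLargestPart (s : ℕ) (x z : ι → ℂ) : Prop :=
  ∃ S : Finset ι, S.card = min s (Fintype.card ι) ∧
    (∀ i ∈ S, ∀ j ∉ S, ‖x j‖ ≤ ‖x i‖) ∧
    (∀ i ∈ S, z i = x i) ∧ (∀ i ∉ S, z i = 0)

end Norms

/-! ### Discrete gradient and total variation -/

/-- The discrete gradient in `ℂ^{N × N × 2}`: the last index `0` is the difference `X_x` in the row
index and `1` the difference `X_y` in the column index, extended by zero in the last row,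
respectively the last column. -/
noncomputable def grad {N : ℕ} (X : Img N N) : Fin N × Fin N × Fin 2 → ℂ := fun q =>
  if q.2.2 = 0 then
    if h : q.1.val + 1 < N then X (⟨q.1.val + 1, h⟩, q.2.1) - X (q.1, q.2.1) else 0
  else
    if h : q.2.1.val + 1 < N then X (q.1, ⟨q.2.1.val + 1, h⟩) - X (q.1, q.2.1) else 0

/-- The (anisotropic) total variation seminorm. -/
noncomputable def tv {N : ℕ} (X : Img N N) : ℝ := l1norm (grad X)

/-! ### Zero padding and the measurement operator -/

/-- `Φ^0`: a row of zeros is added at the top. -/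
noncomputable def padTop {N : ℕ} (Φ : Img (N - 1) N) : Img N N := fun p =>
  if h : p.1.val = 0 then 0 else Φ (⟨p.1.val - 1, by have := p.1.isLt; omega⟩, p.2)

/-- `Φ_0`: a row of zeros is added at the bottom. -/
noncomputable def padBot {N : ℕ} (Φ : Img (N - 1) N) : Img N N := fun p =>
  if h : p.1.val < N - 1 then Φ (⟨p.1.val, h⟩, p.2) else 0

/-- The (non-conjugate) transpose. -/
def transp {a b : ℕ} (X : Img a b) : Img b a := fun p => X (p.2, p.1)

/-- The linear operator with component images `A_j`: `X ↦ (⟨X, A_j⟩)_j`. -/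
noncomputable def ofComponents {a b m : ℕ} (A : Fin m → Img a b) :
    Img a b →ₗ[ℂ] (Fin m → ℂ) where
  toFun X j := imgInner X (A j)
  map_add' X Y := by
    funext j; simp [imgInner, add_mul, Finset.sum_add_distrib]
  map_smul' c X := by
    funext j; simp [imgInner, Finset.mul_sum, mul_assoc]

/-- The component images of a linear operator. -/
noncomputable def components {a b m : ℕ} (A : Img a b →ₗ[ℂ] (Fin m → ℂ)) : Fin m → Img a b :=
  fun j p => star (A (Pi.single p 1) j)

theorem ofComponents_components {a b m : ℕ} (A : Img a b →ₗ[ℂ] (Fin m → ℂ)) :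
    ofComponents (components A) = A := by
  refine LinearMap.pi_ext' fun p => LinearMap.ext_ring ?_
  funext j
  simp [ofComponents, components, imgInner, Pi.single_apply]

/-- `𝒜^0`: the operator whose component images are those of `𝒜`, zero-padded at the top. -/
noncomputable def opTop {N m : ℕ} (A : Img (N - 1) N →ₗ[ℂ] (Fin m → ℂ)) :
    Img N N →ₗ[ℂ] (Fin m → ℂ) := ofComponents fun j => padTop (components A j)

/-- `𝒜_0`: the operator whose component images are those of `𝒜`, zero-padded at the bottom. -/
noncomputable def opBot {N m : ℕ} (A : Img (N - 1) N →ₗ[ℂ] (Fin m → ℂ)) :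
    Img N N →ₗ[ℂ] (Fin m → ℂ) := ofComponents fun j => padBot (components A j)

/-- The concatenated operator `[𝒜 𝒜']`, acting on pairs `(U, V)` of images by
`(U, V) ↦ (𝒜(U), 𝒜'(V))`. -/
noncomputable def concat {ι : Type*} {m : ℕ} (A A' : (ι → ℂ) →ₗ[ℂ] (Fin m → ℂ)) :
    (ι ⊕ ι → ℂ) →ₗ[ℂ] (Fin m ⊕ Fin m → ℂ) where
  toFun L := Sum.elim (A (L ∘ Sum.inl)) (A' (L ∘ Sum.inr))
  map_add' L K := by
    have h1 : (L + K) ∘ Sum.inl = L ∘ Sum.inl + K ∘ Sum.inl := rfl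
    have h2 : (L + K) ∘ Sum.inr = L ∘ Sum.inr + K ∘ Sum.inr := rfl
    funext i; rcases i with i | i <;> simp [h1, h2]
  map_smul' c L := by
    have h1 : (c • L) ∘ Sum.inl = c • (L ∘ Sum.inl) := rfl
    have h2 : (c • L) ∘ Sum.inr = c • (L ∘ Sum.inr) := rfl
    funext i; rcases i with i | i <;> simp [h1, h2]

/-- The measurements `ℳ(X) = (𝒜^0(X), 𝒜_0(X), 𝒜'^0(Xᵀ), 𝒜'_0(Xᵀ), ℬ(X))`, a vector with
`4 m₁ + m₂` entries. -/
noncomputable def measurement {N m₁ m₂ : ℕ} (A A' : Img (N - 1) N →ₗ[ℂ] (Fin m₁ → ℂ))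
    (B : Img N N →ₗ[ℂ] (Fin m₂ → ℂ)) (X : Img N N) :
    Fin m₁ ⊕ Fin m₁ ⊕ Fin m₁ ⊕ Fin m₁ ⊕ Fin m₂ → ℂ :=
  Sum.elim (opTop A X) (Sum.elim (opBot A X)
    (Sum.elim (opTop A' (transp X)) (Sum.elim (opBot A' (transp X)) (B X))))

/-- `X̂` is a minimizer of the total variation among all `Z` with `‖ℳ(Z) - y‖₂ ≤ ε`. -/
def IsTVMinimizer {N : ℕ} {κ : Type*} [Fintype κ] (M : Img N N → κ → ℂ) (y : κ → ℂ) (ε : ℝ)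
    (Xhat : Img N N) : Prop :=
  Xhat ∈ {Z | l2norm (M Z - y) ≤ ε} ∧ IsMinOn tv {Z | l2norm (M Z - y) ≤ ε} Xhat

/-! ### The bivariate Haar transform -/

/-- The univariate functions `H^0` (the indicator function of `[0,1)`) and `H^1` (the Haar mother
wavelet). -/
noncomputable def haarMother (e : Fin 2) (t : ℝ) : ℝ :=
  if e = 0 then (if 0 ≤ t ∧ t < 1 then 1 else 0)
  else (if 0 ≤ t ∧ t < 1 / 2 then 1 else if 1 / 2 ≤ t ∧ t < 1 then -1 else 0)

/-- `H_{j,k}^e (u,v) = 2^j H^{e₁}(2^j u - k₁) H^{e₂}(2^j v - k₂)`. -/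
noncomputable def haarBiv (j : ℕ) (e : Fin 2 × Fin 2) (k : ℕ × ℕ) (u v : ℝ) : ℝ :=
  2 ^ j * (haarMother e.1 (2 ^ j * u - k.1) * haarMother e.2 (2 ^ j * v - k.2))

/-- Indices of the Haar functions of level less than `n`: `none` is the constant function, and
`some ⟨j, e, k⟩` with `j < n`, `e ≠ (0,0)`, `k ∈ {0,…,2^j-1}²` is `H_{j,k}^e`. -/
abbrev HaarIndex (n : ℕ) : Type :=
  Option (Σ j : Fin n, {e : Fin 2 × Fin 2 // e ≠ (0, 0)} × (Fin (2 ^ j.val) × Fin (2 ^ j.val)))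

/-- The bivariate Haar functions on the unit square. -/
noncomputable def haarFunction {n : ℕ} : HaarIndex n → ℝ → ℝ → ℝ
  | none => fun _ _ => 1
  | some ⟨j, e, k⟩ => haarBiv j e (k.1, k.2)

/-- The discrete image `h` of a Haar function, with pixel values `N⁻¹` times the value that the
function takes on the square `[p/N,(p+1)/N) × [q/N,(q+1)/N)`, where `N = 2^n`. -/
noncomputable def haarImage {n : ℕ} (i : HaarIndex n) : Img (2 ^ n) (2 ^ n) := fun p =>
  (((2 : ℝ) ^ n)⁻¹ * haarFunction i ((p.1 : ℕ) / (2 : ℝ) ^ n) ((p.2 : ℕ) / (2 : ℝ) ^ n) : ℝ)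

/-- The discrete Haar coefficients `⟨X, h_i⟩` as a linear map. -/
noncomputable def haarLin (n : ℕ) : Img (2 ^ n) (2 ^ n) →ₗ[ℂ] (HaarIndex n → ℂ) where
  toFun X i := imgInner X (haarImage i)
  map_add' X Y := by
    funext j; simp [imgInner, add_mul, Finset.sum_add_distrib]
  map_smul' c X := by
    funext j; simp [imgInner, Finset.mul_sum, mul_assoc]

/-! The Haar images are orthonormal, so the transform is invertible. -/

theorem sum_range_mul_div (d m : ℕ) (hd : 0 < d) (F : ℕ → ℝ) :
    ∑ p ∈ Finset.range (m * d), F (p / d) = d * ∑ q ∈ Finset.range m, F q := by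
  induction m with
  | zero => simp
  | succ m ih =>
    rw [add_mul, one_mul, Finset.sum_range_add, ih, Finset.sum_range_succ, mul_add]
    congr 1
    rw [Finset.sum_congr rfl (g := fun _ => F m)]
    · simp
    · intro x hx
      have hx := Finset.mem_range.1 hx
      congr 1
      rw [mul_comm, Nat.mul_add_div hd, Nat.div_eq_of_lt hx, add_zero]

theorem sum_range_two_mul (m : ℕ) (F : ℕ → ℝ) :
    ∑ q ∈ Finset.range (2 * m), F q = ∑ a ∈ Finset.range m, (F (2 * a) + F (2 * a + 1)) := by
  induction m with
  | zero => simp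
  | succ m ih =>
    rw [show 2 * (m + 1) = 2 * m + 1 + 1 by ring, Finset.sum_range_succ, Finset.sum_range_succ, ih,
      Finset.sum_range_succ]
    ring

/-- Values of `H^e (· - k)` on half-integer cells. -/
noncomputable def haarStep (e : Fin 2) (k q : ℕ) : ℝ :=
  if q / 2 = k then (if e = 0 then 1 else if q % 2 = 0 then 1 else -1) else 0

theorem haarMother_sample {n j : ℕ} (hj : j < n) (e : Fin 2) (k p : ℕ) :
    haarMother e (2 ^ j * ((p : ℝ) / 2 ^ n) - k) = haarStep e k (p / 2 ^ (n - j - 1)) := by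
  obtain ⟨r, rfl⟩ : ∃ r, n = j + r + 1 := ⟨n - j - 1, by omega⟩
  have hr : j + r + 1 - j - 1 = r := by omega
  rw [hr]
  set d : ℕ := 2 ^ r with hd
  have hd0 : 0 < d := by positivity
  set q := p / d with hq
  have h1 : q * d ≤ p := Nat.div_mul_le_self p d
  have h2 : p < (q + 1) * d := by
    have := Nat.lt_div_mul_add (a := p) hd0
    rw [add_mul, one_mul]; exact this
  have hdR : (0 : ℝ) < d := by exact_mod_cast hd0
  have ht : (2 : ℝ) ^ j * ((p : ℝ) / 2 ^ (j + r + 1)) = p / d / 2 := by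
    rw [hd]; push_cast
    rw [pow_add, pow_add]; field_simp
  rw [ht]
  have h3 : (q : ℝ) ≤ (p : ℝ) / d := by
    rw [le_div_iff₀ hdR]; exact_mod_cast h1
  have h4 : (p : ℝ) / d < q + 1 := by
    rw [div_lt_iff₀ hdR]; exact_mod_cast h2
  set x : ℝ := (p : ℝ) / d with hx
  clear_value x q
  have hqm := Nat.div_add_mod q 2
  have hlt := Nat.mod_lt q (show 2 > 0 by norm_num)
  generalize q / 2 = a at *
  generalize hb : q % 2 = b at *
  have key : ∀ c : ℝ, haarStep e k q = if a = k then (if e = 0 then 1 else if b = 0 then 1 else -1) else 0 := by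
    intro _
    have : q / 2 = a := by omega
    simp only [haarStep, this, hb]
  rw [key 0]
  have hqR : (q : ℝ) = 2 * a + b := by rw [← hqm]; push_cast; ring
  unfold haarMother
  by_cases hak : a = k
  · subst hak
    rcases (show b = 0 ∨ b = 1 by omega) with rfl | rfl
    · push_cast at hqR
      have c1 : 0 ≤ x / 2 - a := by linarith
      have c2 : x / 2 - a < 1 / 2 := by linarith
      have c3 : x / 2 - a < 1 := by linarith
      simp only [c1, c2, c3, and_self, if_true]
    · push_cast at hqR
      have c1 : 0 ≤ x / 2 - a := by linarith
      have c2 : 1 / 2 ≤ x / 2 - a := by linarith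
      have c3 : x / 2 - a < 1 := by linarith
      simp only [c1, c2, c3, not_lt.2 c2, and_self, and_false, if_true, if_false, one_ne_zero]
  · have hbR : (b : ℝ) ≤ 1 := by exact_mod_cast (show b ≤ 1 by omega)
    have hb0 : (0 : ℝ) ≤ b := by positivity
    have c : x / 2 - k < 0 ∨ 1 ≤ x / 2 - k := by
      rcases lt_or_gt_of_ne hak with h | h
      · left
        have : (a : ℝ) + 1 ≤ k := by exact_mod_cast h
        linarith
      · right
        have : (k : ℝ) + 1 ≤ a := by exact_mod_cast h
        linarith
    rw [if_neg hak]
    rcases c with c | c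
    · have d1 : ¬ (0 ≤ x / 2 - k) := not_le.2 c
      have d2 : ¬ (1 / 2 ≤ x / 2 - k) := by linarith
      simp [d1]
      intros; linarith
    · have d1 : ¬ (x / 2 - k < 1) := not_lt.2 c
      have d2 : ¬ (x / 2 - k < 1 / 2) := by linarith
      simp only [d1, d2, and_false, if_false, ite_self]

/-- One-dimensional inner products of sampled Haar functions. -/
noncomputable def haarIp (n j : ℕ) (e : Fin 2) (k : ℕ) (j' : ℕ) (e' : Fin 2) (k' : ℕ) : ℝ :=
  ∑ p ∈ Finset.range (2 ^ n), haarMother e (2 ^ j * ((p : ℝ) / 2 ^ n) - k) *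
    haarMother e' (2 ^ j' * ((p : ℝ) / 2 ^ n) - k')

theorem haarIp_comm (n j : ℕ) (e : Fin 2) (k : ℕ) (j' : ℕ) (e' : Fin 2) (k' : ℕ) :
    haarIp n j e k j' e' k' = haarIp n j' e' k' j e k :=
  Finset.sum_congr rfl fun _ _ => mul_comm _ _

theorem haarIp_same {n j : ℕ} (hj : j < n) (e e' : Fin 2) {k k' : ℕ} (hk : k < 2 ^ j) :
    haarIp n j e k j e' k' = if e = e' ∧ k = k' then (2 : ℝ) ^ n / 2 ^ j else 0 := by
  obtain ⟨r, rfl⟩ : ∃ r, n = j + r + 1 := ⟨n - j - 1, by omega⟩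
  have hr : j + r + 1 - j - 1 = r := by omega
  unfold haarIp
  simp only [haarMother_sample hj, hr]
  rw [show 2 ^ (j + r + 1) = (2 * 2 ^ j) * 2 ^ r by ring,
    sum_range_mul_div (2 ^ r) (2 * 2 ^ j) (by positivity)
      (fun q => haarStep e k q * haarStep e' k' q), sum_range_two_mul]
  have hs : ∀ a : ℕ, haarStep e k (2 * a) * haarStep e' k' (2 * a) +
      haarStep e k (2 * a + 1) * haarStep e' k' (2 * a + 1) =
      if a = k then (if e = e' ∧ k = k' then 2 else 0) else 0 := by
    intro a
    have h1 : (2 * a + 1) / 2 = a := by omega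
    have h2 : (2 * a + 1) % 2 = 1 := by omega
    have h3 : 2 * a / 2 = a := by omega
    have h4 : 2 * a % 2 = 0 := by omega
    simp only [haarStep, h1, h2, h3, h4]
    by_cases ha : a = k
    · subst ha
      by_cases hk' : a = k'
      · subst hk'
        fin_cases e <;> fin_cases e' <;> norm_num
      · simp [hk']
    · simp [ha]
  rw [Finset.sum_congr rfl fun a _ => hs a, Finset.sum_ite_eq' (Finset.range (2 ^ j)),
    if_pos (Finset.mem_range.2 hk)]
  split_ifs
  · push_cast
    rw [pow_add, pow_add]; field_simp
  · simp

theorem haarIp_lt {n j j' : ℕ} (hjj : j < j') (hj : j' < n) (e : Fin 2) (k k' : ℕ) :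
    haarIp n j e k j' 1 k' = 0 := by
  obtain ⟨r, rfl⟩ : ∃ r, n = j' + r + 1 := ⟨n - j' - 1, by omega⟩
  obtain ⟨t, rfl⟩ : ∃ t, j' = j + t + 1 := ⟨j' - j - 1, by omega⟩
  have hr : j + t + 1 + r + 1 - (j + t + 1) - 1 = r := by omega
  have hr' : j + t + 1 + r + 1 - j - 1 = r + (t + 1) := by omega
  unfold haarIp
  simp only [haarMother_sample hj, haarMother_sample (hjj.trans hj), hr, hr']
  simp only [pow_add 2 r, ← Nat.div_div_eq_div_mul]
  rw [show 2 ^ (j + t + 1 + r + 1) = (2 * 2 ^ (j + t + 1)) * 2 ^ r by ring,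
    sum_range_mul_div (2 ^ r) (2 * 2 ^ (j + t + 1)) (by positivity)
      (fun q => haarStep e k (q / 2 ^ (t + 1)) * haarStep 1 k' q), sum_range_two_mul]
  rw [Finset.sum_eq_zero, mul_zero]
  intro a _
  have h1 : (2 * a + 1) / 2 = a := by omega
  have h2 : (2 * a + 1) % 2 = 1 := by omega
  have h3 : 2 * a / 2 = a := by omega
  have h4 : 2 * a % 2 = 0 := by omega
  rw [pow_succ', ← Nat.div_div_eq_div_mul, ← Nat.div_div_eq_div_mul, h1, h3]
  have h5 : haarStep 1 k' (2 * a + 1) = -haarStep 1 k' (2 * a) := by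
    simp only [haarStep, h1, h2, h3, h4]
    split_ifs <;> simp_all
  rw [h5]; ring

/-- The inner product of two bivariate Haar images, without the normalization `4^{-n}`. -/
theorem haarBiv_ip (n j : ℕ) (e : Fin 2 × Fin 2) (k : ℕ × ℕ) (j' : ℕ) (e' : Fin 2 × Fin 2)
    (k' : ℕ × ℕ) :
    ∑ p : Fin (2 ^ n) × Fin (2 ^ n),
      haarBiv j e k ((p.1 : ℕ) / (2 : ℝ) ^ n) ((p.2 : ℕ) / (2 : ℝ) ^ n) *
      haarBiv j' e' k' ((p.1 : ℕ) / (2 : ℝ) ^ n) ((p.2 : ℕ) / (2 : ℝ) ^ n) =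
    2 ^ j * 2 ^ j' * (haarIp n j e.1 k.1 j' e'.1 k'.1 * haarIp n j e.2 k.2 j' e'.2 k'.2) := by
  unfold haarIp
  rw [← Fin.sum_univ_eq_sum_range (fun p => haarMother e.1 (2 ^ j * ((p : ℝ) / 2 ^ n) - k.1) *
      haarMother e'.1 (2 ^ j' * ((p : ℝ) / 2 ^ n) - k'.1)),
    ← Fin.sum_univ_eq_sum_range (fun p => haarMother e.2 (2 ^ j * ((p : ℝ) / 2 ^ n) - k.2) *
      haarMother e'.2 (2 ^ j' * ((p : ℝ) / 2 ^ n) - k'.2)),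
    Finset.sum_mul_sum, Finset.mul_sum, Fintype.sum_prod_type]
  refine Finset.sum_congr rfl fun p _ => ?_
  rw [Finset.mul_sum]
  refine Finset.sum_congr rfl fun q _ => ?_
  unfold haarBiv
  ring

theorem haarBiv_ip_lt {n j j' : ℕ} (hjj : j < j') (hj : j' < n) (e e' : Fin 2 × Fin 2)
    (he' : e' ≠ (0, 0)) (k k' : ℕ × ℕ) :
    haarIp n j e.1 k.1 j' e'.1 k'.1 * haarIp n j e.2 k.2 j' e'.2 k'.2 = 0 := by
  have : e'.1 = 1 ∨ e'.2 = 1 := by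
    obtain ⟨a, b⟩ := e'
    fin_cases a <;> fin_cases b <;> simp_all
  rcases this with h | h
  · rw [h, haarIp_lt hjj hj, zero_mul]
  · rw [h, haarIp_lt hjj hj, mul_zero]

theorem haarBiv_ip_same {n j : ℕ} (hj : j < n) (e e' : Fin 2 × Fin 2) (k k' : ℕ × ℕ)
    (h1 : k.1 < 2 ^ j) (h2 : k.2 < 2 ^ j) :
    (2 : ℝ) ^ j * 2 ^ j * (haarIp n j e.1 k.1 j e'.1 k'.1 * haarIp n j e.2 k.2 j e'.2 k'.2) =
      if e = e' ∧ k = k' then (2 : ℝ) ^ n * 2 ^ n else 0 := by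
  rw [haarIp_same hj _ _ h1, haarIp_same hj _ _ h2]
  by_cases h : e = e' ∧ k = k'
  · obtain ⟨rfl, rfl⟩ := h
    simp only [and_self, if_true]
    field_simp
  · rw [if_neg h]
    have : ¬ (e.1 = e'.1 ∧ k.1 = k'.1) ∨ ¬ (e.2 = e'.2 ∧ k.2 = k'.2) := by
      by_contra hc
      push Not at hc
      exact h ⟨Prod.ext hc.1.1 hc.2.1, Prod.ext hc.1.2 hc.2.2⟩
    rcases this with h | h <;> simp [h]

theorem haarFunction_none_eq {n : ℕ} (p : Fin (2 ^ n) × Fin (2 ^ n)) :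
    haarFunction (none : HaarIndex n) ((p.1 : ℕ) / (2 : ℝ) ^ n) ((p.2 : ℕ) / (2 : ℝ) ^ n) =
      haarBiv 0 (0, 0) (0, 0) ((p.1 : ℕ) / (2 : ℝ) ^ n) ((p.2 : ℕ) / (2 : ℝ) ^ n) := by
  have h : ∀ q : Fin (2 ^ n), (0 : ℝ) ≤ (q : ℕ) / (2 : ℝ) ^ n ∧ ((q : ℕ) : ℝ) / (2 : ℝ) ^ n < 1 := by
    intro q
    refine ⟨by positivity, ?_⟩
    rw [div_lt_one (by positivity)]
    exact_mod_cast q.isLt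
  simp [haarFunction, haarBiv, haarMother, h p.1, h p.2]

theorem haarFunction_ip {n : ℕ} (i i' : HaarIndex n) :
    ∑ p : Fin (2 ^ n) × Fin (2 ^ n),
      haarFunction i ((p.1 : ℕ) / (2 : ℝ) ^ n) ((p.2 : ℕ) / (2 : ℝ) ^ n) *
      haarFunction i' ((p.1 : ℕ) / (2 : ℝ) ^ n) ((p.2 : ℕ) / (2 : ℝ) ^ n) =
    if i = i' then (2 : ℝ) ^ n * 2 ^ n else 0 := by
  rcases i with _ | ⟨j, e, k⟩ <;> rcases i' with _ | ⟨j', e', k'⟩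
  · simp [haarFunction]
  · simp only [haarFunction_none_eq]
    simp only [haarFunction]
    rw [haarBiv_ip, if_neg (by simp)]
    rcases Nat.eq_zero_or_pos j'.val with h | h
    · have hk1 := k'.1.isLt
      have hk2 := k'.2.isLt
      have := haarBiv_ip_same (n := n) (j := 0) (by have := j'.isLt; omega) (0, 0) e'.1 (0, 0)
        (k'.1.val, k'.2.val) (by simp) (by simp)
      generalize k'.1.val = a at this ⊢
      generalize k'.2.val = b at this ⊢
      rw [h, this, if_neg]
      exact fun hc => e'.2 hc.1.symm
    · rw [haarBiv_ip_lt h j'.isLt _ _ e'.2, mul_zero]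
  · simp only [haarFunction_none_eq]
    simp only [haarFunction]
    rw [haarBiv_ip, if_neg (by simp)]
    rw [haarIp_comm, haarIp_comm n j e.1.2]
    rcases Nat.eq_zero_or_pos j.val with h | h
    · have := haarBiv_ip_same (n := n) (j := 0) (by have := j.isLt; omega) (0, 0) e.1 (0, 0)
        (k.1.val, k.2.val) (by simp) (by simp)
      generalize k.1.val = a at this ⊢
      generalize k.2.val = b at this ⊢
      rw [h, this, if_neg]
      exact fun hc => e.2 hc.1.symm
    · rw [haarBiv_ip_lt h j.isLt _ _ e.2, mul_zero]
  · simp only [haarFunction]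
    rw [haarBiv_ip]
    rcases lt_trichotomy j j' with h | h | h
    · rw [haarBiv_ip_lt h j'.isLt _ _ e'.2, mul_zero, if_neg]
      intro hc
      have := congrArg Sigma.fst (Option.some.inj hc)
      exact h.ne this
    · subst h
      rw [haarBiv_ip_same j.isLt _ _ _ _ k.1.isLt k.2.isLt]
      congr 1
      simp [Prod.ext_iff, Subtype.ext_iff, Fin.ext_iff]
    · rw [haarIp_comm, haarIp_comm n j e.1.2, haarBiv_ip_lt h j.isLt _ _ e.2, mul_zero, if_neg]
      intro hc
      have := congrArg Sigma.fst (Option.some.inj hc)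
      exact h.ne this.symm

theorem haarImage_orthonormal {n : ℕ} (i i' : HaarIndex n) :
    imgInner (haarImage i) (haarImage i') = if i = i' then 1 else 0 := by
  have h := haarFunction_ip i i'
  have h2 : ∑ p : Fin (2 ^ n) × Fin (2 ^ n),
      (((2 : ℝ) ^ n)⁻¹ * haarFunction i ((p.1 : ℕ) / (2 : ℝ) ^ n) ((p.2 : ℕ) / (2 : ℝ) ^ n)) *
      (((2 : ℝ) ^ n)⁻¹ * haarFunction i' ((p.1 : ℕ) / (2 : ℝ) ^ n) ((p.2 : ℕ) / (2 : ℝ) ^ n)) =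
      if i = i' then 1 else 0 := by
    have : ∀ a b : ℝ, ((2 : ℝ) ^ n)⁻¹ * a * (((2 : ℝ) ^ n)⁻¹ * b) =
        ((2 : ℝ) ^ n * 2 ^ n)⁻¹ * (a * b) := by
      intro a b; rw [mul_inv]; ring
    simp only [this]
    rw [← Finset.mul_sum, h]
    split_ifs
    · field_simp
    · simp
  unfold imgInner haarImage
  have h3 := congrArg (fun x : ℝ => (x : ℂ)) h2
  rw [Complex.ofReal_sum, apply_ite Complex.ofReal, Complex.ofReal_one, Complex.ofReal_zero] at h3
  rw [← h3]
  refine Finset.sum_congr rfl fun p _ => ?_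
  rw [Complex.star_def, Complex.conj_ofReal, ← Complex.ofReal_mul]

theorem card_haarIndex (n : ℕ) :
    Fintype.card (HaarIndex n) = Fintype.card (Fin (2 ^ n) × Fin (2 ^ n)) := by
  have h : Fintype.card {e : Fin 2 × Fin 2 // e ≠ (0, 0)} = 3 := by decide
  have h2 : ∀ n : ℕ, ∑ j ∈ Finset.range n, 3 * (2 ^ j * 2 ^ j) + 1 = 2 ^ n * 2 ^ n := by
    intro n
    induction n with
    | zero => simp
    | succ n ih =>
      rw [Finset.sum_range_succ, pow_succ]
      linarith
  simp only [Fintype.card_option, Fintype.card_sigma, Fintype.card_prod, Fintype.card_fin, h]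
  rw [Fin.sum_univ_eq_sum_range (fun j => 3 * (2 ^ j * 2 ^ j)), h2]

theorem haarLin_bijective (n : ℕ) : Function.Bijective (haarLin n) := by
  have hs : Function.Surjective (haarLin n) := by
    intro c
    refine ⟨∑ i, c i • haarImage i, ?_⟩
    have h : ∀ i : HaarIndex n, haarLin n (haarImage i) = Pi.single i 1 := by
      intro i
      funext i'
      change imgInner (haarImage i) (haarImage i') = _
      rw [haarImage_orthonormal, Pi.single_apply]
      simp only [eq_comm]
    rw [map_sum]
    simp only [map_smul, h]
    funext i
    simp [Pi.single_apply]
  refine ⟨?_, hs⟩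
  rw [LinearMap.injective_iff_surjective_of_finrank_eq_finrank]
  · exact hs
  · simp only [Module.finrank_fintype_fun_eq_card]
    exact (card_haarIndex n).symm

/-- The discrete bivariate Haar transform `ℋ`. -/
noncomputable def haarTransform (n : ℕ) : Img (2 ^ n) (2 ^ n) ≃ₗ[ℂ] (HaarIndex n → ℂ) :=
  LinearEquiv.ofBijective (haarLin n) (haarLin_bijective n)

end TVRecovery

open TVRecovery

/-! The proof has two halves. The first treats the gradient as the unknown of a compressed sensing
problem. Summation by parts (`imgInner_rowDiff`) shows that `𝒜` applied to the row differences of an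
image is the difference of the measurement blocks `𝒜^0` and `𝒜_0`; transposition handles the column
differences. Since the true image is feasible, the minimizer has no larger total variation, and the
error `D = X - X̂` has measurements of size at most `2ε`. Thus the gradient error lies in the `ℓ₁`
cone (`sum_compl_norm_sub_le`) and has small image under an operator with restricted isometry, which
forces it to be small in both norms (`HasRIP.recovery`, `gradient_recovery`).

The second half turns a bound on `tv D` into one on `‖D‖₂`. A Haar coefficient at level `j` carries
the normalization `2^j / N`, which cancels the length of the wavelet's half-support. Hence the
coefficients of one level and one type have `ℓ₁` norm at most the total variation, whatever the
level (`sum_norm_haarLin_le_tv`). Put the levels below about `log₄ s` into the head: these are at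
most `s` coefficients, and about `log₄ (N²/s)` levels remain. So the tail has `ℓ₁` norm at most a
multiple of `log (N²/s) * tv D`; no decay of rearranged coefficients is needed. Restricted isometry
of `ℬℋ⁻¹` controls the head by `‖ℬ D‖₂` and the tail, and Parseval returns to the image.

Both halves rest on `HasRIP.exists_head`, which splits a vector into a sparse part controlled by its
measurements and a remainder controlled by an `ℓ₁` tail divided by `√t`. -/

namespace TVRecovery

/-! ### Restricted isometry and block decompositions -/

section Norms

variable {ι κ : Type*} [Fintype ι] [Fintype κ]

theorem l2norm_eq_norm (x : ι → ℂ) : l2norm x = ‖WithLp.toLp 2 x‖ := by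
  rw [EuclideanSpace.norm_eq]; rfl

theorem l2norm_nonneg (x : ι → ℂ) : 0 ≤ l2norm x := Real.sqrt_nonneg _

theorem l1norm_nonneg (x : ι → ℂ) : 0 ≤ l1norm x := Finset.sum_nonneg fun _ _ => norm_nonneg _

theorem l2norm_sq (x : ι → ℂ) : l2norm x ^ 2 = ∑ i, ‖x i‖ ^ 2 :=
  Real.sq_sqrt (Finset.sum_nonneg fun _ _ => sq_nonneg _)

@[simp]
theorem l2norm_zero : l2norm (0 : ι → ℂ) = 0 := by simp [l2norm]

theorem l2norm_add_le (x y : ι → ℂ) : l2norm (x + y) ≤ l2norm x + l2norm y := by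
  simp only [l2norm_eq_norm, WithLp.toLp_add]
  exact norm_add_le _ _

theorem l2norm_sub_le (x y : ι → ℂ) : l2norm (x - y) ≤ l2norm x + l2norm y := by
  simp only [l2norm_eq_norm, WithLp.toLp_sub]
  exact norm_sub_le _ _

theorem l2norm_sub_comm (x y : ι → ℂ) : l2norm (x - y) = l2norm (y - x) := by
  simp only [l2norm_eq_norm, WithLp.toLp_sub]
  exact norm_sub_rev _ _

omit [Fintype ι] in
theorem indicator_add_indicator_sdiff [DecidableEq ι] {W F : Finset ι} (h : W ⊆ F) (x : ι → ℂ) :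
    (W : Set ι).indicator x + ((F \ W : Finset ι) : Set ι).indicator x =
      (F : Set ι).indicator x := by
  funext i
  have := @h i
  by_cases h1 : i ∈ W <;> by_cases h2 : i ∈ F <;> simp_all

theorem indicator_add_indicator_compl [DecidableEq ι] (W : Finset ι) (x : ι → ℂ) :
    (W : Set ι).indicator x + ((Wᶜ : Finset ι) : Set ι).indicator x = x := by
  rw [Finset.compl_eq_univ_sdiff, indicator_add_indicator_sdiff (Finset.subset_univ _)]
  simp

omit [Fintype ι] in
theorem isSparse_indicator {t : ℕ} {W : Finset ι} (h : W.card ≤ t) (x : ι → ℂ) :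
    IsSparse t ((W : Set ι).indicator x) := by
  refine le_trans (Set.ncard_le_ncard ?_ W.finite_toSet) ((Set.ncard_coe_finset W).trans_le h)
  exact Set.support_indicator_subset

theorem l2norm_indicator_sq (W : Finset ι) (x : ι → ℂ) :
    l2norm ((W : Set ι).indicator x) ^ 2 = ∑ i ∈ W, ‖x i‖ ^ 2 := by
  classical
  rw [l2norm_sq]
  simp only [Set.indicator_apply, Finset.mem_coe, apply_ite norm, norm_zero, ite_pow,
    zero_pow two_ne_zero]
  rw [Finset.sum_ite_mem, Finset.univ_inter]

theorem l2norm_indicator_mono {V W : Finset ι} (h : V ⊆ W) (x : ι → ℂ) :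
    l2norm ((V : Set ι).indicator x) ≤ l2norm ((W : Set ι).indicator x) := by
  refine le_of_sq_le_sq ?_ (l2norm_nonneg _)
  rw [l2norm_indicator_sq, l2norm_indicator_sq]
  exact Finset.sum_le_sum_of_subset_of_nonneg h fun _ _ _ => sq_nonneg _

theorem l1norm_indicator_le {s : ℕ} {W : Finset ι} (h : W.card ≤ s) (x : ι → ℂ) :
    ∑ i ∈ W, ‖x i‖ ≤ √s * l2norm ((W : Set ι).indicator x) := by
  refine le_of_sq_le_sq ?_ (by have := l2norm_nonneg ((W : Set ι).indicator x); positivity)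
  rw [mul_pow, Real.sq_sqrt (Nat.cast_nonneg _), l2norm_indicator_sq]
  refine sq_sum_le_card_mul_sum_sq.trans ?_
  gcongr

/-- Entries dominated by the entries of a block of size `t`. -/
theorem l2norm_indicator_le_of_dominated {t : ℕ} (ht : 0 < t) {V W : Finset ι} {x : ι → ℂ}
    (hV : V.card ≤ t) (hW : W.card = t) (h : ∀ i ∈ W, ∀ j ∈ V, ‖x j‖ ≤ ‖x i‖) :
    l2norm ((V : Set ι).indicator x) ≤ (∑ i ∈ W, ‖x i‖) / √t := by
  have ht' : (0 : ℝ) < t := by exact_mod_cast ht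
  have hs : 0 < √(t : ℝ) := Real.sqrt_pos.2 ht'
  have hn : 0 ≤ ∑ i ∈ W, ‖x i‖ := Finset.sum_nonneg fun _ _ => norm_nonneg _
  -- Each entry on `V` is at most the average magnitude over `W`.
  have h1 : ∀ j ∈ V, ‖x j‖ ≤ (∑ i ∈ W, ‖x i‖) / t := by
    intro j hj
    rw [le_div_iff₀ ht', mul_comm, ← hW, ← nsmul_eq_mul]
    exact Finset.card_nsmul_le_sum _ _ _ fun i hi => h i hi j hj
  refine le_of_sq_le_sq ?_ (by positivity)
  rw [l2norm_indicator_sq, div_pow, Real.sq_sqrt ht'.le]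
  calc ∑ i ∈ V, ‖x i‖ ^ 2 ≤ ∑ i ∈ V, ((∑ i ∈ W, ‖x i‖) / t) ^ 2 :=
        Finset.sum_le_sum fun j hj => by have := h1 j hj; gcongr
    _ = V.card * ((∑ i ∈ W, ‖x i‖) / t) ^ 2 := by simp
    _ ≤ t * ((∑ i ∈ W, ‖x i‖) / t) ^ 2 := by gcongr
    _ = _ := by field_simp

omit [Fintype ι] in
/-- A set of `t` entries of largest magnitude within `F`. -/
theorem exists_largest_subset (t : ℕ) (F : Finset ι) (x : ι → ℂ) (h : t ≤ F.card) :
    ∃ W ⊆ F, W.card = t ∧ ∀ i ∈ W, ∀ j ∈ F, j ∉ W → ‖x j‖ ≤ ‖x i‖ := by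
  classical
  induction t with
  | zero => exact ⟨∅, by simp, by simp, by simp⟩
  | succ t ih =>
    obtain ⟨W, hWF, hWc, hW⟩ := ih (by omega)
    have hne : (F \ W).Nonempty := by
      rw [← Finset.card_pos, Finset.card_sdiff_of_subset hWF]; omega
    obtain ⟨m, hm, hmax⟩ := Finset.exists_max_image (F \ W) (fun i => ‖x i‖) hne
    rw [Finset.mem_sdiff] at hm
    refine ⟨insert m W, Finset.insert_subset hm.1 hWF, ?_, ?_⟩
    · rw [Finset.card_insert_of_notMem hm.2, hWc]
    · intro i hi j hj hjW
      rw [Finset.mem_insert, not_or] at hjW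
      have hjm := hmax j (Finset.mem_sdiff.2 ⟨hj, hjW.2⟩)
      rcases Finset.mem_insert.1 hi with rfl | hi
      · exact hjm
      · exact hW i hi j hj hjW.2

/-- Decomposition of the remainder after the `t` largest entries into blocks of size `t`. -/
theorem exists_block_tail_le {t : ℕ} (ht : 0 < t) (x : ι → ℂ) (p : (ι → ℂ) → ℝ)
    (hzero : p 0 = 0) (hadd : ∀ y z, p (y + z) ≤ p y + p z)
    (hp : ∀ y, IsSparse t y → p y ≤ l2norm y) [DecidableEq ι] (F : Finset ι) :
    ∃ W ⊆ F, W.card ≤ t ∧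
      p (((F \ W : Finset ι) : Set ι).indicator x) ≤ (∑ i ∈ F, ‖x i‖) / √t := by
  induction hc : F.card using Nat.strong_induction_on generalizing F with
  | _ c ih =>
    rcases le_or_gt F.card t with h | h
    · refine ⟨F, subset_rfl, h, ?_⟩
      rw [Finset.sdiff_self, Finset.coe_empty, Set.indicator_empty']
      refine hzero.trans_le ?_
      exact div_nonneg (Finset.sum_nonneg fun _ _ => norm_nonneg _) (Real.sqrt_nonneg _)
    · obtain ⟨W, hWF, hWc, hW⟩ := exists_largest_subset t F x h.le
      obtain ⟨V, hVF, hVc, hV⟩ := ih (F \ W).card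
        (by rw [Finset.card_sdiff_of_subset hWF]; omega) (F \ W) rfl
      refine ⟨W, hWF, hWc.le, ?_⟩
      rw [← indicator_add_indicator_sdiff hVF]
      -- The `ℓ₂` norm of each block is charged to the `ℓ₁` norm of the preceding one. The recursive
      -- bound on the remainder uses only the mass of `F \ W`, so the charges add up to the mass of
      -- `F`.
      have h1 := l2norm_indicator_le_of_dominated ht hVc hWc (x := x) fun i hi j hj => by
        have := Finset.mem_sdiff.1 (hVF hj)
        exact hW i hi j this.1 this.2
      have h2 := hp _ (isSparse_indicator hVc x)
      have h5 := Finset.sum_sdiff (f := fun i => ‖x i‖) hWF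
      refine (hadd _ _).trans ?_
      rw [← h5, add_div]
      linarith

/-- Consequence of the restricted isometry property for a signal with given head `S`. -/
theorem HasRIP.exists_head [DecidableEq ι] {s t r : ℕ} {δ : ℝ} {T : (ι → ℂ) →ₗ[ℂ] (κ → ℂ)}
    (hT : HasRIP r δ T) (ht : 0 < t) (hr : r = s + t) (x : ι → ℂ) {S : Finset ι}
    (hS : S.card ≤ s) :
    ∃ W, S ⊆ W ∧
      l2norm (((Wᶜ : Finset ι) : Set ι).indicator x) ≤ (∑ i ∈ Sᶜ, ‖x i‖) / √t ∧
      √(1 - δ) * l2norm ((W : Set ι).indicator x) ≤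
        l2norm (T x) + √(1 + δ) * ((∑ i ∈ Sᶜ, ‖x i‖) / √t) := by
  obtain ⟨h0, h1, hT⟩ := hT
  have hup : ∀ y, IsSparse t y → l2norm (T y) ≤ √(1 + δ) * l2norm y := by
    intro y hy
    refine le_of_sq_le_sq ?_ (mul_nonneg (Real.sqrt_nonneg _) (l2norm_nonneg _))
    rw [mul_pow, Real.sq_sqrt (by linarith)]
    exact (hT y (le_trans hy (by omega))).2
  have hlow : ∀ y, IsSparse r y → √(1 - δ) * l2norm y ≤ l2norm (T y) := by
    intro y hy
    refine le_of_sq_le_sq ?_ (l2norm_nonneg _)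
    rw [mul_pow, Real.sq_sqrt (by linarith)]
    exact (hT y hy).1
  have key : ∃ V ⊆ Sᶜ, V.card ≤ t ∧
      l2norm (((Sᶜ \ V : Finset ι) : Set ι).indicator x) ≤ (∑ i ∈ Sᶜ, ‖x i‖) / √t ∧
      l2norm (T (((Sᶜ \ V : Finset ι) : Set ι).indicator x)) ≤
        √(1 + δ) * ((∑ i ∈ Sᶜ, ‖x i‖) / √t) := by
    -- Taking a maximum lets one block `V` serve for the `ℓ₂` norm of the remainder and for the norm
    -- of its image under `T`.
    let p : (ι → ℂ) → ℝ := fun y => max (l2norm (T y) / √(1 + δ)) (l2norm y)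
    have hs : 0 < √(1 + δ) := Real.sqrt_pos.2 (by linarith)
    obtain ⟨V, hVS, hVc, hV⟩ := exists_block_tail_le ht x p (by simp [p])
      (by
        intro y z
        refine max_le ?_ ?_
        · refine le_trans ?_ (add_le_add (le_max_left _ _) (le_max_left _ _))
          rw [← add_div, map_add]
          gcongr
          exact l2norm_add_le _ _
        · exact (l2norm_add_le _ _).trans (add_le_add (le_max_right _ _) (le_max_right _ _)))
      (by
        intro y hy
        refine max_le ?_ le_rfl
        rw [div_le_iff₀ hs, mul_comm]
        exact hup y hy) Sᶜ
    refine ⟨V, hVS, hVc, (le_max_right _ _).trans hV, ?_⟩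
    have := (le_max_left _ _).trans hV
    rwa [div_le_iff₀ hs, mul_comm] at this
  obtain ⟨V, hVS, hVc, hV1, hV2⟩ := key
  have hc : (S ∪ V)ᶜ = Sᶜ \ V := by ext i; simp
  refine ⟨S ∪ V, Finset.subset_union_left, by rwa [hc], ?_⟩
  have hx : ((S ∪ V : Finset ι) : Set ι).indicator x =
      x - (((S ∪ V)ᶜ : Finset ι) : Set ι).indicator x := by
    rw [eq_sub_iff_add_eq, indicator_add_indicator_compl]
  -- The lower isometry bound applies to the head, whose image is `T x` minus the image of the
  -- remainder.
  refine (hlow _ (isSparse_indicator ?_ x)).trans ?_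
  · exact (Finset.card_union_le _ _).trans (by omega)
  · rw [hx, map_sub]
    refine (l2norm_sub_le _ _).trans ?_
    rw [hc]
    linarith

theorem l2norm_le_head_add_tail [DecidableEq ι] (W : Finset ι) (x : ι → ℂ) :
    l2norm x ≤ l2norm ((W : Set ι).indicator x) +
      l2norm (((Wᶜ : Finset ι) : Set ι).indicator x) := by
  conv_lhs => rw [← indicator_add_indicator_compl W x]
  exact l2norm_add_le _ _

end Norms

end TVRecovery
namespace TVRecovery

/-! ### Stability of `ℓ₁` minimization -/

section Recovery

variable {ι κ : Type*} [Fintype ι] [Fintype κ]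

/-- The cone constraint satisfied by a competitor of smaller `ℓ₁` norm. -/
theorem sum_compl_norm_sub_le [DecidableEq ι] {a b : ι → ℂ} (hab : l1norm b ≤ l1norm a)
    (S : Finset ι) :
    ∑ i ∈ Sᶜ, ‖(a - b) i‖ ≤ ∑ i ∈ S, ‖(a - b) i‖ + 2 * ∑ i ∈ Sᶜ, ‖a i‖ := by
  unfold l1norm at hab
  rw [← Finset.sum_add_sum_compl S, ← Finset.sum_add_sum_compl S (fun i => ‖a i‖)] at hab
  have h1 : ∑ i ∈ S, ‖a i‖ ≤ ∑ i ∈ S, ‖(a - b) i‖ + ∑ i ∈ S, ‖b i‖ := by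
    rw [← Finset.sum_add_distrib]
    refine Finset.sum_le_sum fun i _ => ?_
    simpa using norm_add_le (a i - b i) (b i)
  have h2 : ∑ i ∈ Sᶜ, ‖(a - b) i‖ ≤ ∑ i ∈ Sᶜ, ‖a i‖ + ∑ i ∈ Sᶜ, ‖b i‖ := by
    rw [← Finset.sum_add_distrib]
    exact Finset.sum_le_sum fun i _ => norm_sub_le _ _
  linarith

/-- Stability of `ℓ₁` minimization under the restricted isometry property. -/
theorem HasRIP.recovery [DecidableEq ι] {s : ℕ} {δ : ℝ} {T : (ι → ℂ) →ₗ[ℂ] (κ → ℂ)}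
    (hT : HasRIP (5 * s) δ T) (hs : 1 ≤ s) (hδ : δ < 1 / 3) {a b : ι → ℂ}
    (hab : l1norm b ≤ l1norm a) {S : Finset ι} (hS : S.card ≤ s) {η : ℝ}
    (hη : l2norm (T (a - b)) ≤ η) :
    l2norm (a - b) ≤ 10 * ((∑ i ∈ Sᶜ, ‖a i‖) / √s + η) ∧
      l1norm (a - b) ≤ 14 * (∑ i ∈ Sᶜ, ‖a i‖ + √s * η) := by
  have hδ0 := hT.1
  have hs' : (0 : ℝ) < s := by exact_mod_cast hs
  have hr : 0 < √(s : ℝ) := Real.sqrt_pos.2 hs'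
  have hcone := sum_compl_norm_sub_le hab S
  -- Blocks of size `4s` give the factor `√(4s) = 2√s`. It halves the head's contribution to its own
  -- bound through the cone constraint, so that `w` can be absorbed on the left.
  obtain ⟨W, hSW, hW1, hW2⟩ := hT.exists_head (t := 4 * s) (by omega) (by ring) (a - b) hS
  have h4 : √((4 * s : ℕ) : ℝ) = 2 * √(s : ℝ) := by
    push_cast
    rw [Real.sqrt_mul (by norm_num), show (4 : ℝ) = 2 ^ 2 by norm_num,
      Real.sqrt_sq (by norm_num)]
  rw [h4] at hW1 hW2
  set w := l2norm ((W : Set ι).indicator (a - b)) with hw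
  set u := (∑ i ∈ Sᶜ, ‖a i‖) / √(s : ℝ) with hu
  have hσ : ∑ i ∈ Sᶜ, ‖a i‖ = √s * u := by rw [hu]; field_simp
  have hw0 : 0 ≤ w := l2norm_nonneg _
  have hη0 : 0 ≤ η := (l2norm_nonneg _).trans hη
  have hu0 : 0 ≤ u := div_nonneg (Finset.sum_nonneg fun _ _ => norm_nonneg _) hr.le
  have hhead : ∑ i ∈ S, ‖(a - b) i‖ ≤ √s * w :=
    (l1norm_indicator_le hS _).trans (by gcongr; exact l2norm_indicator_mono hSW _)
  have htail : (∑ i ∈ Sᶜ, ‖(a - b) i‖) / (2 * √(s : ℝ)) ≤ w / 2 + u := by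
    rw [div_le_iff₀ (by positivity)]
    nlinarith
  -- Rational bounds for `√(2/3)` and `√(4/3)`. They leave `4/5 - 29/50 = 11/50 > 0` as coefficient
  -- of `w`, whence `w ≤ 6 (u + η)` with constants independent of `δ`.
  have hlo : 4 / 5 ≤ √(1 - δ) := Real.le_sqrt_of_sq_le (by linarith)
  have hup : √(1 + δ) ≤ 29 / 25 := Real.sqrt_le_iff.2 ⟨by norm_num, by linarith⟩
  have hw1 : 4 / 5 * w ≤ η + 29 / 25 * (w / 2 + u) :=
    calc 4 / 5 * w ≤ √(1 - δ) * w := by gcongr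
      _ ≤ _ := hW2
      _ ≤ η + 29 / 25 * (w / 2 + u) := by gcongr
  constructor
  · have := l2norm_le_head_add_tail W (a - b)
    linarith
  · have h1 : l1norm (a - b) = ∑ i ∈ S, ‖(a - b) i‖ + ∑ i ∈ Sᶜ, ‖(a - b) i‖ :=
      (Finset.sum_add_sum_compl S _).symm
    have h2 : √(s : ℝ) * w ≤ √s * (6 * (u + η)) := by gcongr; linarith
    rw [h1, hσ]
    rw [hσ] at hcone
    have h3 : 0 ≤ √(s : ℝ) * η := by positivity
    nlinarith

end Recovery

/-! ### The gradient and its measurements -/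

section Gradient

variable {N : ℕ}

/-- Differences in the row index, without zero padding. -/
def rowDiff (X : Img N N) : Img (N - 1) N := fun p =>
  X (⟨p.1.val + 1, by have := p.1.isLt; omega⟩, p.2) -
    X (⟨p.1.val, by have := p.1.isLt; omega⟩, p.2)

/-- Summation by parts: the two zero paddings are the adjoints of the two shifted restrictions whose
difference is `rowDiff`. -/
theorem imgInner_rowDiff (X : Img N N) (Φ : Img (N - 1) N) :
    imgInner (rowDiff X) Φ = imgInner X (padTop Φ) - imgInner X (padBot Φ) := by
  rcases N with _ | M
  · simp [imgInner]
  · have t0 : ∀ q, padTop Φ (0, q) = 0 := fun q => dif_pos rfl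
    have t1 : ∀ (p : Fin M) q, padTop Φ (p.succ, q) = Φ (p, q) := fun p q => dif_neg (Nat.succ_ne_zero _)
    have b0 : ∀ q, padBot Φ (Fin.last M, q) = 0 := fun q => dif_neg (lt_irrefl M)
    have b1 : ∀ (p : Fin M) q, padBot Φ (p.castSucc, q) = Φ (p, q) := fun p q => dif_pos p.isLt
    have hT : imgInner X (padTop Φ) =
        ∑ p : Fin M, ∑ q : Fin (M + 1), X (p.succ, q) * star (Φ (p, q)) := by
      unfold imgInner
      rw [Fintype.sum_prod_type, Fin.sum_univ_succ]
      simp only [t0, t1, star_zero, mul_zero, Finset.sum_const_zero, zero_add]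
    have hB : imgInner X (padBot Φ) =
        ∑ p : Fin M, ∑ q : Fin (M + 1), X (p.castSucc, q) * star (Φ (p, q)) := by
      unfold imgInner
      rw [Fintype.sum_prod_type, Fin.sum_univ_castSucc]
      simp only [b0, b1, star_zero, mul_zero, Finset.sum_const_zero, add_zero]
    have hR : imgInner (rowDiff X) Φ = ∑ p : Fin M, ∑ q : Fin (M + 1),
        (X (p.succ, q) - X (p.castSucc, q)) * star (Φ (p, q)) :=
      Fintype.sum_prod_type (fun i : Fin M × Fin (M + 1) => rowDiff X i * star (Φ i))
    rw [hT, hB, hR, ← Finset.sum_sub_distrib]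
    refine Finset.sum_congr rfl fun p _ => ?_
    rw [← Finset.sum_sub_distrib]
    exact Finset.sum_congr rfl fun q _ => sub_mul _ _ _

theorem map_rowDiff {m : ℕ} (A : Img (N - 1) N →ₗ[ℂ] (Fin m → ℂ)) (X : Img N N) :
    A (rowDiff X) = opTop A X - opBot A X := by
  conv_lhs => rw [← ofComponents_components A]
  funext j
  exact imgInner_rowDiff X (components A j)

/-- Position in the gradient of the row differences of `X` and of `Xᵀ`. -/
def gradIndex (N : ℕ) :
    (Fin (N - 1) × Fin N) ⊕ (Fin (N - 1) × Fin N) → Fin N × Fin N × Fin 2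
  | .inl p => (⟨p.1.val, by have := p.1.isLt; omega⟩, p.2, 0)
  | .inr p => (p.2, ⟨p.1.val, by have := p.1.isLt; omega⟩, 1)

theorem gradIndex_injective : Function.Injective (gradIndex N) := by
  rintro (⟨a, b⟩ | ⟨a, b⟩) (⟨c, d⟩ | ⟨c, d⟩) h <;>
    simp_all [gradIndex, Prod.ext_iff, Fin.ext_iff]

theorem grad_comp_gradIndex (X : Img N N) :
    grad X ∘ gradIndex N = Sum.elim (rowDiff X) (rowDiff (transp X)) := by
  funext i
  rcases i with p | p
  · have := p.1.isLt
    have h : p.1.val + 1 < N := by omega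
    simp [grad, gradIndex, rowDiff, h]
  · have := p.1.isLt
    have h : p.1.val + 1 < N := by omega
    simp [grad, gradIndex, rowDiff, transp, h]

/-- The missed positions are the padded last row and last column. Discarding them preserves both
norms of the gradient, so the restricted isometry on pairs of `(N - 1) × N` images can be used. -/
theorem grad_eq_zero_of_notMem_range (X : Img N N) {i : Fin N × Fin N × Fin 2}
    (hi : i ∉ Set.range (gradIndex N)) : grad X i = 0 := by
  obtain ⟨p, q, r⟩ := i
  unfold grad
  split_ifs with h1 h2 h2
  · obtain rfl : r = 0 := h1
    exact absurd ⟨Sum.inl (⟨p.val, by simp only at h2; omega⟩, q), rfl⟩ hi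
  · rfl
  · obtain rfl : r = 1 := by simp only at h1; omega
    exact absurd ⟨Sum.inr (⟨q.val, by simp only at h2; omega⟩, p), rfl⟩ hi
  · rfl

theorem sum_grad_eq_sum_comp_gradIndex (f : ℂ → ℝ) (hf : f 0 = 0) (X : Img N N) :
    ∑ i, f ((grad X ∘ gradIndex N) i) = ∑ i, f (grad X i) :=
  Fintype.sum_of_injective _ gradIndex_injective _ _
    (fun i hi => by rw [grad_eq_zero_of_notMem_range X hi, hf]) fun _ => rfl

theorem grad_sub (X Y : Img N N) : grad (X - Y) = grad X - grad Y := by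
  funext i
  simp only [grad, Pi.sub_apply]
  split_ifs <;> ring

theorem tv_eq (X : Img N N) : tv X = l1norm (grad X ∘ gradIndex N) :=
  (sum_grad_eq_sum_comp_gradIndex (fun z => ‖z‖) norm_zero X).symm

theorem l2norm_grad (X : Img N N) : l2norm (grad X) = l2norm (grad X ∘ gradIndex N) := by
  unfold l2norm
  rw [← sum_grad_eq_sum_comp_gradIndex (fun z => ‖z‖ ^ 2) (by simp) X]

theorem measurement_sub {m₁ m₂ : ℕ} (A A' : Img (N - 1) N →ₗ[ℂ] (Fin m₁ → ℂ))
    (B : Img N N →ₗ[ℂ] (Fin m₂ → ℂ)) (X Y : Img N N) :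
    measurement A A' B (X - Y) = measurement A A' B X - measurement A A' B Y := by
  have ht : transp (X - Y) = transp X - transp Y := rfl
  funext i
  rcases i with i | i | i | i | i <;> simp [measurement, ht]

theorem l2norm_measurement_sq {m₁ m₂ : ℕ} (A A' : Img (N - 1) N →ₗ[ℂ] (Fin m₁ → ℂ))
    (B : Img N N →ₗ[ℂ] (Fin m₂ → ℂ)) (X : Img N N) :
    l2norm (measurement A A' B X) ^ 2 = l2norm (opTop A X) ^ 2 + (l2norm (opBot A X) ^ 2 +
      (l2norm (opTop A' (transp X)) ^ 2 + (l2norm (opBot A' (transp X)) ^ 2 +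
        l2norm (B X) ^ 2))) := by
  simp [l2norm_sq, measurement]

theorem l2norm_map_le_measurement {m₁ m₂ : ℕ} (A A' : Img (N - 1) N →ₗ[ℂ] (Fin m₁ → ℂ))
    (B : Img N N →ₗ[ℂ] (Fin m₂ → ℂ)) (X : Img N N) :
    l2norm (B X) ≤ l2norm (measurement A A' B X) := by
  refine le_of_sq_le_sq ?_ (l2norm_nonneg _)
  rw [l2norm_measurement_sq]
  nlinarith [sq_nonneg (l2norm (opTop A X)), sq_nonneg (l2norm (opBot A X)),
    sq_nonneg (l2norm (opTop A' (transp X))), sq_nonneg (l2norm (opBot A' (transp X)))]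

/-- By summation by parts the left side is built from differences of measurement blocks. The
parallelogram bound costs a factor `√2`, rounded up to `3/2`. -/
theorem l2norm_concat_grad_le {m₁ m₂ : ℕ} (A A' : Img (N - 1) N →ₗ[ℂ] (Fin m₁ → ℂ))
    (B : Img N N →ₗ[ℂ] (Fin m₂ → ℂ)) (X : Img N N) :
    l2norm (concat A A' (grad X ∘ gradIndex N)) ≤ 3 / 2 * l2norm (measurement A A' B X) := by
  have h : concat A A' (grad X ∘ gradIndex N) =
      Sum.elim (opTop A X - opBot A X) (opTop A' (transp X) - opBot A' (transp X)) := by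
    rw [grad_comp_gradIndex, ← map_rowDiff, ← map_rowDiff]
    rfl
  refine le_of_sq_le_sq ?_ (mul_nonneg (by norm_num) (l2norm_nonneg _))
  have h1 : ∀ x y : Fin m₁ → ℂ, l2norm (x - y) ^ 2 ≤ 2 * (l2norm x ^ 2 + l2norm y ^ 2) := by
    intro x y
    have := l2norm_sub_le x y
    have := l2norm_nonneg (x - y)
    nlinarith [sq_nonneg (l2norm x - l2norm y)]
  have h2 : l2norm (concat A A' (grad X ∘ gradIndex N)) ^ 2 =
      l2norm (opTop A X - opBot A X) ^ 2 +
        l2norm (opTop A' (transp X) - opBot A' (transp X)) ^ 2 := by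
    rw [h]
    simp [l2norm_sq]
  rw [h2, mul_pow, l2norm_measurement_sq]
  have := h1 (opTop A X) (opBot A X)
  have := h1 (opTop A' (transp X)) (opBot A' (transp X))
  nlinarith [sq_nonneg (l2norm (opTop A X)), sq_nonneg (l2norm (opBot A X)),
    sq_nonneg (l2norm (opTop A' (transp X))), sq_nonneg (l2norm (opBot A' (transp X))),
    sq_nonneg (l2norm (B X))]

/-- Stability of the gradient of a total variation minimizer. -/
theorem gradient_recovery {s m₁ m₂ : ℕ} {δ : ℝ} (hs : 1 ≤ s) (hδ : δ < 1 / 3)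
    {A A' : Img (N - 1) N →ₗ[ℂ] (Fin m₁ → ℂ)} (B : Img N N →ₗ[ℂ] (Fin m₂ → ℂ))
    (hA : HasRIP (5 * s) δ (concat A A')) {X Y : Img N N} (hXY : tv Y ≤ tv X) {ε : ℝ}
    (hM : l2norm (measurement A A' B (X - Y)) ≤ 2 * ε)
    {G : Fin N × Fin N × Fin 2 → ℂ} (hG : IsLargestPart s (grad X) G) :
    l2norm (grad X - grad Y) ≤ 42 * (l1norm (grad X - G) / √s + ε) ∧
      tv (X - Y) ≤ 42 * (l1norm (grad X - G) + √s * ε) := by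
  obtain ⟨S, hSc, -, hS1, hS0⟩ := hG
  have hs0 : 0 < √(s : ℝ) := Real.sqrt_pos.2 (by exact_mod_cast hs)
  have hε : 0 ≤ ε := by have := (l2norm_nonneg _).trans hM; linarith
  -- The head of the full gradient, transported to the unpadded differences.
  set S' : Finset ((Fin (N - 1) × Fin N) ⊕ (Fin (N - 1) × Fin N)) :=
    S.preimage (gradIndex N) gradIndex_injective.injOn with hS'
  have hS'c : S'.card ≤ s := by
    refine le_trans ?_ (hSc.trans_le (min_le_left _ _))
    exact Finset.card_le_card_of_injOn _ (fun i hi => Finset.mem_preimage.1 hi)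
      gradIndex_injective.injOn
  have hσ : ∑ i ∈ S'ᶜ, ‖(grad X ∘ gradIndex N) i‖ ≤ l1norm (grad X - G) := by
    have h1 : ∀ i ∈ S'ᶜ, ‖(grad X ∘ gradIndex N) i‖ = ‖(grad X - G) (gradIndex N i)‖ := by
      intro i hi
      have : gradIndex N i ∉ S := by simpa [hS'] using hi
      simp [hS0 _ this]
    rw [Finset.sum_congr rfl h1]
    have h2 := Finset.sum_map S'ᶜ ⟨gradIndex N, gradIndex_injective⟩ fun i => ‖(grad X - G) i‖
    refine h2.symm.trans_le ?_
    exact Finset.sum_le_univ_sum_of_nonneg fun _ => norm_nonneg _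
  have hsub : grad X ∘ gradIndex N - grad Y ∘ gradIndex N = grad (X - Y) ∘ gradIndex N := by
    rw [grad_sub]; rfl
  -- `3 = 3/2 * 2`; together with the factor `14` of `HasRIP.recovery` this gives the constant `42`.
  have hη : l2norm (concat A A' (grad X ∘ gradIndex N - grad Y ∘ gradIndex N)) ≤ 3 * ε := by
    rw [hsub]
    have := l2norm_concat_grad_le A A' B (X - Y)
    linarith
  obtain ⟨h1, h2⟩ := hA.recovery hs hδ (by rwa [← tv_eq, ← tv_eq]) hS'c hη
  rw [hsub] at h1 h2
  rw [← l2norm_grad, grad_sub] at h1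
  rw [← tv_eq] at h2
  have h3 : (∑ i ∈ S'ᶜ, ‖(grad X ∘ gradIndex N) i‖) / √(s : ℝ) ≤ l1norm (grad X - G) / √s := by
    gcongr
  have h4 : 0 ≤ l1norm (grad X - G) / √(s : ℝ) := div_nonneg (l1norm_nonneg _) hs0.le
  have h5 := l1norm_nonneg (grad X - G)
  have h6 : 0 ≤ √(s : ℝ) * ε := by positivity
  constructor <;> linarith

end Gradient

end TVRecovery
namespace TVRecovery

/-! ### Haar coefficients and total variation -/

section HaarLevels

theorem sum_range_mul {M : Type*} [AddCommMonoid M] (m d : ℕ) (F : ℕ → M) :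
    ∑ p ∈ Finset.range (m * d), F p =
      ∑ a ∈ Finset.range m, ∑ r ∈ Finset.range d, F (a * d + r) := by
  induction m with
  | zero => simp
  | succ m ih => rw [add_mul, one_mul, Finset.sum_range_add, ih, Finset.sum_range_succ]

/-- The wavelet is `1` on the first half and `-1` on the second half of a block of length `2d`, so
its coefficient pairs values at distance `d`. -/
theorem sum_mul_haarStep (g : ℕ → ℂ) {m d k : ℕ} (hd : 0 < d) (hk : k < m) :
    ∑ p ∈ Finset.range (m * (2 * d)), g p * (haarStep 1 k (p / d) : ℂ) =
      ∑ r ∈ Finset.range d, (g (k * (2 * d) + r) - g (k * (2 * d) + r + d)) := by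
  have h : ∀ a, ∑ r ∈ Finset.range (2 * d),
      g (a * (2 * d) + r) * (haarStep 1 k ((a * (2 * d) + r) / d) : ℂ) =
      if a = k then
        ∑ r ∈ Finset.range d, (g (k * (2 * d) + r) - g (k * (2 * d) + r + d)) else 0 := by
    intro a
    rw [two_mul d, Finset.sum_range_add, ← Finset.sum_add_distrib, ← two_mul d]
    have h0 : ∀ r ∈ Finset.range d, (a * (2 * d) + r) / d = 2 * a := by
      intro r hr
      rw [show a * (2 * d) + r = d * (2 * a) + r by ring, Nat.mul_add_div hd,
        Nat.div_eq_of_lt (Finset.mem_range.1 hr), add_zero]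
    have h1 : ∀ r ∈ Finset.range d, (a * (2 * d) + (d + r)) / d = 2 * a + 1 := by
      intro r hr
      rw [show a * (2 * d) + (d + r) = d * (2 * a + 1) + r by ring, Nat.mul_add_div hd,
        Nat.div_eq_of_lt (Finset.mem_range.1 hr), add_zero]
    split_ifs with hak
    · subst hak
      refine Finset.sum_congr rfl fun r hr => ?_
      have e1 : (2 * a + 1) / 2 = a := by omega
      rw [h0 r hr, h1 r hr, show a * (2 * d) + (d + r) = a * (2 * d) + r + d by ring]
      simp [haarStep, e1]
      ring
    · refine Finset.sum_eq_zero fun r hr => ?_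
      have e1 : (2 * a + 1) / 2 = a := by omega
      rw [h0 r hr, h1 r hr]
      simp [haarStep, e1, hak]
  rw [sum_range_mul, Finset.sum_congr rfl fun a _ => h a, Finset.sum_ite_eq',
    if_pos (Finset.mem_range.2 hk)]

/-- The univariate Haar coefficients of one level are bounded by the variation. -/
theorem sum_norm_sum_mul_haarStep_le (g : ℕ → ℂ) (v : ℕ → ℝ) (hv0 : ∀ p, 0 ≤ v p)
    {m d : ℕ} (hd : 0 < d) (hv : ∀ p, p + 1 < m * (2 * d) → ‖g (p + 1) - g p‖ ≤ v p) :
    ∑ k ∈ Finset.range m,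
        ‖∑ p ∈ Finset.range (m * (2 * d)), g p * (haarStep 1 k (p / d) : ℂ)‖ ≤
      d * ∑ p ∈ Finset.range (m * (2 * d)), v p := by
  rw [sum_range_mul m (2 * d) v, Finset.mul_sum]
  refine Finset.sum_le_sum fun k hk => ?_
  have hk := Finset.mem_range.1 hk
  rw [sum_mul_haarStep g hd hk]
  -- The block lies inside the range, so only increments covered by `hv` occur. Each of the `d`
  -- differences telescopes within the block, whence the factor `d`; distinct blocks are disjoint.
  have hb : k * (2 * d) + 2 * d ≤ m * (2 * d) := by
    have := Nat.mul_le_mul_right (2 * d) (Nat.succ_le_of_lt hk)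
    rw [Nat.succ_mul] at this
    exact this
  have hr : ∀ r ∈ Finset.range d, ‖g (k * (2 * d) + r) - g (k * (2 * d) + r + d)‖ ≤
      ∑ i ∈ Finset.range (2 * d), v (k * (2 * d) + i) := by
    intro r hr
    have hr := Finset.mem_range.1 hr
    rw [← dist_eq_norm]
    refine (dist_le_Ico_sum_of_dist_le (d := v) (by omega) ?_).trans ?_
    · intro i _ hi
      rw [dist_comm, dist_eq_norm]
      exact hv i (by omega)
    · have h := Finset.sum_Ico_eq_sum_range v (k * (2 * d)) (k * (2 * d) + 2 * d)
      rw [Nat.add_sub_cancel_left] at h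
      rw [← h]
      refine Finset.sum_le_sum_of_subset_of_nonneg ?_ fun _ _ _ => hv0 _
      exact Finset.Ico_subset_Ico (by omega) (by omega)
  refine (norm_sum_le_of_le _ hr).trans_eq ?_
  simp

/-- The translates at one level have disjoint supports, so at most one term is nonzero. -/
theorem sum_norm_haarStep_le (e : Fin 2) (m q : ℕ) :
    ∑ k ∈ Finset.range m, ‖(haarStep e k q : ℂ)‖ ≤ 1 := by
  have h : ∀ k, ‖(haarStep e k q : ℂ)‖ = if q / 2 = k then 1 else 0 := by
    intro k
    unfold haarStep
    split_ifs <;> simp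
  simp only [h, Finset.sum_ite_eq]
  split_ifs <;> norm_num

/-- Tensor products of `H¹` with `H^e`: the coefficients of one level are bounded by the variation
in the first coordinate. -/
theorem sum_norm_sum_mul_haarStep_mul_le (Y : ℕ → ℕ → ℂ) (v : ℕ → ℕ → ℝ)
    (hv0 : ∀ p q, 0 ≤ v p q) (e : Fin 2) {m d : ℕ} (hd : 0 < d)
    (hv : ∀ p q, p + 1 < m * (2 * d) → ‖Y (p + 1) q - Y p q‖ ≤ v p q) :
    ∑ k ∈ Finset.range m, ∑ l ∈ Finset.range m,
        ‖∑ p ∈ Finset.range (m * (2 * d)), ∑ q ∈ Finset.range (m * (2 * d)),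
          Y p q * (haarStep 1 k (p / d) * haarStep e l (q / d))‖ ≤
      d * ∑ p ∈ Finset.range (m * (2 * d)), ∑ q ∈ Finset.range (m * (2 * d)), v p q := by
  set N := m * (2 * d) with hN
  set c : ℕ → ℕ → ℝ := fun k q =>
    ‖∑ p ∈ Finset.range N, Y p q * (haarStep 1 k (p / d) : ℂ)‖ with hc
  have h1 : ∀ k l, ‖∑ p ∈ Finset.range N, ∑ q ∈ Finset.range N,
      Y p q * (haarStep 1 k (p / d) * haarStep e l (q / d))‖ ≤
      ∑ q ∈ Finset.range N, c k q * ‖(haarStep e l (q / d) : ℂ)‖ := by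
    intro k l
    rw [Finset.sum_comm]
    refine norm_sum_le_of_le _ fun q _ => ?_
    simp only [← mul_assoc]
    rw [← Finset.sum_mul, norm_mul]
  have h2 : ∀ k, ∑ l ∈ Finset.range m, ∑ q ∈ Finset.range N,
      c k q * ‖(haarStep e l (q / d) : ℂ)‖ ≤ ∑ q ∈ Finset.range N, c k q := by
    intro k
    rw [Finset.sum_comm]
    refine Finset.sum_le_sum fun q _ => ?_
    rw [← Finset.mul_sum]
    exact mul_le_of_le_one_right (norm_nonneg _) (sum_norm_haarStep_le e m _)
  calc _ ≤ ∑ k ∈ Finset.range m, ∑ q ∈ Finset.range N, c k q :=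
        Finset.sum_le_sum fun k _ => (Finset.sum_le_sum fun l _ => h1 k l).trans (h2 k)
    _ = ∑ q ∈ Finset.range N, ∑ k ∈ Finset.range m, c k q := Finset.sum_comm
    _ ≤ ∑ q ∈ Finset.range N, d * ∑ p ∈ Finset.range N, v p q :=
        Finset.sum_le_sum fun q _ => sum_norm_sum_mul_haarStep_le (fun p => Y p q)
          (fun p => v p q) (fun p => hv0 p q) hd fun p => hv p q
    _ = _ := by rw [← Finset.mul_sum, Finset.sum_comm]

/-- Extension by zero of a function on the pixels. -/
def extendZero {M : Type*} [Zero M] {N : ℕ} (f : Fin N × Fin N → M) (p q : ℕ) : M :=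
  if h : p < N ∧ q < N then f (⟨p, h.1⟩, ⟨q, h.2⟩) else 0

@[simp]
theorem extendZero_val {M : Type*} [Zero M] {N : ℕ} (f : Fin N × Fin N → M) (p q : Fin N) :
    extendZero f p q = f (p, q) := dif_pos ⟨p.isLt, q.isLt⟩

theorem sum_fin_prod_eq_sum_range {M : Type*} [AddCommMonoid M] (N : ℕ) (F : ℕ → ℕ → M) :
    ∑ x : Fin N × Fin N, F x.1 x.2 = ∑ p ∈ Finset.range N, ∑ q ∈ Finset.range N, F p q := by
  rw [Fintype.sum_prod_type, ← Fin.sum_univ_eq_sum_range fun p => ∑ q ∈ Finset.range N, F p q]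
  exact Finset.sum_congr rfl fun p _ => Fin.sum_univ_eq_sum_range (F p) N

theorem sum_extendZero {M : Type*} [AddCommMonoid M] {N : ℕ} (f : Fin N × Fin N → M) :
    ∑ p ∈ Finset.range N, ∑ q ∈ Finset.range N, extendZero f p q = ∑ x, f x := by
  rw [← sum_fin_prod_eq_sum_range]
  simp

theorem extendZero_nonneg {N : ℕ} {f : Fin N × Fin N → ℝ} (hf : ∀ x, 0 ≤ f x) (p q : ℕ) :
    0 ≤ extendZero f p q := by
  unfold extendZero
  split_ifs
  · exact hf _
  · exact le_rfl

theorem tv_eq_sum_add_sum {N : ℕ} (X : Img N N) :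
    tv X = ∑ x : Fin N × Fin N, ‖grad X (x.1, x.2, 0)‖ +
      ∑ x : Fin N × Fin N, ‖grad X (x.1, x.2, 1)‖ := by
  simp only [tv, l1norm, Fintype.sum_prod_type, Fin.sum_univ_two, Finset.sum_add_distrib]

theorem norm_extendZero_sub_le_row {N : ℕ} (X : Img N N) {p q : ℕ} (hp : p + 1 < N) :
    ‖extendZero X (p + 1) q - extendZero X p q‖ ≤
      extendZero (fun x => ‖grad X (x.1, x.2, 0)‖) p q := by
  have hp' : p < N := by omega
  by_cases hq : q < N
  · simp [extendZero, hp, hp', hq, grad]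
  · simp [extendZero, hq]

theorem norm_extendZero_sub_le_col {N : ℕ} (X : Img N N) {p q : ℕ} (hq : q + 1 < N) :
    ‖extendZero X p (q + 1) - extendZero X p q‖ ≤
      extendZero (fun x => ‖grad X (x.1, x.2, 1)‖) p q := by
  have hq' : q < N := by omega
  by_cases hp : p < N
  · simp [extendZero, hp, hq', hq, grad]
  · simp [extendZero, hp]

/-- On the pixel grid a level `j` function is constant on cells of side `2^(n-j-1)`, which reduces
the coefficient to a sum over integer indices. -/
theorem haarLin_some {n : ℕ} (X : Img (2 ^ n) (2 ^ n)) (j : Fin n)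
    (e : {e : Fin 2 × Fin 2 // e ≠ (0, 0)}) (k : Fin (2 ^ j.val) × Fin (2 ^ j.val)) :
    haarLin n X (some ⟨j, e, k⟩) = (2 ^ j.val / 2 ^ n : ℝ) *
      ∑ p ∈ Finset.range (2 ^ n), ∑ q ∈ Finset.range (2 ^ n), extendZero X p q *
        (haarStep e.1.1 k.1 (p / 2 ^ (n - j - 1)) * haarStep e.1.2 k.2 (q / 2 ^ (n - j - 1))) := by
  rw [← sum_fin_prod_eq_sum_range (2 ^ n) fun p q => extendZero X p q *
    (haarStep e.1.1 k.1 (p / 2 ^ (n - j - 1)) * haarStep e.1.2 k.2 (q / 2 ^ (n - j - 1)) : ℂ),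
    Finset.mul_sum]
  change imgInner X _ = _
  refine Finset.sum_congr rfl fun x _ => ?_
  rw [extendZero_val, Complex.star_def, haarImage, Complex.conj_ofReal]
  simp only [haarFunction, haarBiv, haarMother_sample j.isLt]
  push_cast
  ring

theorem eq_one_or_eq_one_of_ne_zero {e : Fin 2 × Fin 2} (he : e ≠ (0, 0)) :
    e.1 = 1 ∨ e.2 = 1 := by
  revert e
  decide

/-- The Haar coefficients of one level and one type are summable with the total variation. -/
theorem sum_norm_haarLin_le_tv {n : ℕ} (X : Img (2 ^ n) (2 ^ n)) (j : Fin n)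
    (e : {e : Fin 2 × Fin 2 // e ≠ (0, 0)}) :
    ∑ k, ‖haarLin n X (some ⟨j, e, k⟩)‖ ≤ tv X := by
  set d : ℕ := 2 ^ (n - j - 1) with hd
  have hd0 : 0 < d := by positivity
  have hN : 2 ^ n = 2 ^ j.val * (2 * d) := by
    rw [hd, ← pow_succ', ← pow_add]
    congr 1
    have := j.isLt
    omega
  set c : ℝ := 2 ^ j.val / 2 ^ n with hc
  have hc0 : 0 ≤ c := by positivity
  -- In fact `c * d = 1/2`: in two dimensions the normalization offsets the length scale, so the
  -- bound does not depend on the level.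
  have hcd : c * d ≤ 1 := by
    have : (2 : ℝ) ^ n = 2 ^ j.val * (2 * d) := by exact_mod_cast hN
    rw [hc, this, div_mul_eq_mul_div, div_le_one (by positivity)]
    have : (0 : ℝ) ≤ 2 ^ j.val * d := by positivity
    linarith
  have key : ∀ V : ℝ, 0 ≤ V → V ≤ tv X →
      (∑ k ∈ Finset.range (2 ^ j.val), ∑ l ∈ Finset.range (2 ^ j.val),
        ‖∑ p ∈ Finset.range (2 ^ n), ∑ q ∈ Finset.range (2 ^ n), extendZero X p q *
          (haarStep e.1.1 k (p / d) * haarStep e.1.2 l (q / d))‖ ≤ d * V) →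
      ∑ k, ‖haarLin n X (some ⟨j, e, k⟩)‖ ≤ tv X := by
    intro V hV0 hV h
    have hn : ‖(2 ^ j.val / 2 ^ n : ℝ)‖ = c := Real.norm_of_nonneg hc0
    simp only [haarLin_some, norm_mul, Complex.norm_real, hn]
    rw [← Finset.mul_sum, sum_fin_prod_eq_sum_range (2 ^ j.val) fun k l =>
      ‖∑ p ∈ Finset.range (2 ^ n), ∑ q ∈ Finset.range (2 ^ n), extendZero X p q *
          (haarStep e.1.1 k (p / d) * haarStep e.1.2 l (q / d))‖]
    calc _ ≤ c * (d * V) := by gcongr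
      _ = c * d * V := by ring
      _ ≤ 1 * V := by gcongr
      _ ≤ tv X := by rwa [one_mul]
  have h0 : (0 : ℝ) ≤ ∑ x : Fin (2 ^ n) × Fin (2 ^ n), ‖grad X (x.1, x.2, 0)‖ :=
    Finset.sum_nonneg fun _ _ => norm_nonneg _
  have h1 : (0 : ℝ) ≤ ∑ x : Fin (2 ^ n) × Fin (2 ^ n), ‖grad X (x.1, x.2, 1)‖ :=
    Finset.sum_nonneg fun _ _ => norm_nonneg _
  have htv := tv_eq_sum_add_sum X
  rcases eq_one_or_eq_one_of_ne_zero e.2 with he | he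
  · refine key _ h0 (by linarith) ?_
    rw [← sum_extendZero, he]
    have := sum_norm_sum_mul_haarStep_mul_le (extendZero X)
      (extendZero fun x => ‖grad X (x.1, x.2, 0)‖) (extendZero_nonneg fun _ => norm_nonneg _)
      e.1.2 (m := 2 ^ j.val) hd0 fun p q hp =>
        norm_extendZero_sub_le_row X (by rw [hN]; exact hp)
    rwa [← hN] at this
  -- The wavelet oscillates in the second coordinate, so the tensor estimate is applied to the
  -- transposed image.
  · refine key _ h1 (by linarith) ?_
    rw [← sum_extendZero, he, Finset.sum_comm]
    have := sum_norm_sum_mul_haarStep_mul_le (fun p q => extendZero X q p)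
      (fun p q => extendZero (fun x => ‖grad X (x.1, x.2, 1)‖) q p)
      (fun _ _ => extendZero_nonneg (fun _ => norm_nonneg _) _ _)
      e.1.1 (m := 2 ^ j.val) hd0 fun p q hp =>
        norm_extendZero_sub_le_col X (by rw [hN]; exact hp)
    rw [← hN] at this
    rw [Finset.sum_comm (s := Finset.range (2 ^ n)) (f := extendZero fun x => _)]
    refine le_trans (le_of_eq ?_) this
    refine Finset.sum_congr rfl fun k _ => Finset.sum_congr rfl fun l _ => ?_
    rw [Finset.sum_comm]
    simp only [mul_comm (haarStep 1 k _ : ℂ)]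

/-- Indices of the constant function and of the Haar functions of level less than `J`. -/
def coarseIndex {J n : ℕ} (h : J ≤ n) : HaarIndex J → HaarIndex n
  | none => none
  | some ⟨j, x⟩ => some ⟨Fin.castLE h j, x⟩

/-- The fine Haar coefficients are summable with a factor proportional to the number of levels. -/
theorem exists_coarse_set {J n : ℕ} (h : J ≤ n) :
    ∃ S : Finset (HaarIndex n), S.card ≤ 4 ^ J ∧ ∀ X : Img (2 ^ n) (2 ^ n),
      ∑ i ∈ Sᶜ, ‖haarLin n X i‖ ≤ 3 * (n - J : ℕ) * tv X := by
  refine ⟨Finset.univ.image (coarseIndex h), ?_, fun X => ?_⟩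
  · refine Finset.card_image_le.trans ?_
    rw [Finset.card_univ, card_haarIndex]
    simp [← mul_pow]
  set S := Finset.univ.image (coarseIndex h) with hS
  -- The constant coefficient must be in the head, since total variation does not see constants.
  have hnone : (none : HaarIndex n) ∈ S := Finset.mem_image.2 ⟨none, Finset.mem_univ _, rfl⟩
  have hsome : ∀ (j : Fin n) x, j.val < J → (some ⟨j, x⟩ : HaarIndex n) ∈ S :=
    fun j x hj => Finset.mem_image.2 ⟨some ⟨⟨j.val, hj⟩, x⟩, Finset.mem_univ _, rfl⟩
  have h3 : Fintype.card {e : Fin 2 × Fin 2 // e ≠ (0, 0)} = 3 := by decide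
  have hlevel : ∀ j : Fin n, ∑ x, (if some ⟨j, x⟩ ∈ Sᶜ then ‖haarLin n X (some ⟨j, x⟩)‖ else 0) ≤
      if J ≤ j.val then 3 * tv X else 0 := by
    intro j
    split_ifs with hj
    · calc _ ≤ ∑ x, ‖haarLin n X (some ⟨j, x⟩)‖ := by
            refine Finset.sum_le_sum fun x _ => ?_
            split_ifs
            · exact le_rfl
            · exact norm_nonneg _
        _ = ∑ e, ∑ k, ‖haarLin n X (some ⟨j, e, k⟩)‖ := Fintype.sum_prod_type _
        _ ≤ ∑ _e : {e : Fin 2 × Fin 2 // e ≠ (0, 0)}, tv X :=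
            Finset.sum_le_sum fun e _ => sum_norm_haarLin_le_tv X j e
        _ = 3 * tv X := by simp [h3]
    · refine (Finset.sum_eq_zero fun x _ => if_neg ?_).le
      simpa using hsome j x (not_le.1 hj)
  rw [← Finset.univ_inter Sᶜ, ← Finset.sum_ite_mem, Fintype.sum_option, Fintype.sum_sigma,
    if_neg (by simpa using hnone), zero_add]
  refine (Finset.sum_le_sum fun j _ => hlevel j).trans ?_
  rw [Fin.sum_univ_eq_sum_range (fun j => if J ≤ j then 3 * tv X else 0), ← Finset.sum_filter]
  have : (Finset.range n).filter (J ≤ ·) = Finset.Ico J n := by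
    ext i; simp [and_comm]
  rw [this]
  simp
  linarith

/-- Parseval's identity for the Haar transform. -/
theorem l2norm_haarLin {n : ℕ} (X : Img (2 ^ n) (2 ^ n)) : l2norm (haarLin n X) = l2norm X := by
  have h : ∀ i : HaarIndex n, haarLin n (haarImage i) = Pi.single i 1 := by
    intro i
    funext i'
    change imgInner (haarImage i) (haarImage i') = _
    rw [haarImage_orthonormal, Pi.single_apply]
    simp only [eq_comm]
  have hX : X = ∑ i, haarLin n X i • haarImage i := by
    apply (haarLin_bijective n).1
    rw [map_sum]
    simp only [map_smul, h]
    funext i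
    simp [Pi.single_apply]
  have hsq : ∀ {ι : Type} [Fintype ι] (x : ι → ℂ), imgInner x x = ((l2norm x ^ 2 : ℝ) : ℂ) := by
    intro ι _ x
    rw [l2norm_sq]
    push_cast
    refine Finset.sum_congr rfl fun i _ => ?_
    rw [Complex.star_def, Complex.mul_conj, Complex.normSq_eq_norm_sq]
    push_cast
    rfl
  have h1 : imgInner X X = imgInner (haarLin n X) (haarLin n X) := by
    have : ∀ p, star (X p) = ∑ i, star (haarLin n X i) * star (haarImage i p) := by
      intro p
      conv_lhs => rw [hX]
      simp [Finset.sum_apply]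
    unfold imgInner
    simp only [this, Finset.mul_sum]
    rw [Finset.sum_comm]
    refine Finset.sum_congr rfl fun i _ => ?_
    change _ = (∑ p, X p * star (haarImage i p)) * _
    rw [Finset.sum_mul]
    exact Finset.sum_congr rfl fun p _ => by ring
  rw [hsq, hsq, Complex.ofReal_inj] at h1
  exact ((sq_eq_sq₀ (l2norm_nonneg _) (l2norm_nonneg _)).1 h1).symm

/-- With `s` coefficients removed, the `ℓ₁` norm of the Haar coefficients is bounded by the total
variation up to a factor `log (N² / s)`. -/
theorem exists_haar_head {n s : ℕ} (hs : 1 ≤ s) (hsn : 2 * s ≤ (2 ^ n) ^ 2) :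
    ∃ S : Finset (HaarIndex n), S.card ≤ s ∧ ∀ X : Img (2 ^ n) (2 ^ n),
      ∑ i ∈ Sᶜ, ‖haarLin n X i‖ ≤ 9 * Real.log (((2 : ℝ) ^ n) ^ 2 / s) * tv X := by
  have h4n : (2 ^ n) ^ 2 = 4 ^ n := by rw [← pow_mul, mul_comm, pow_mul]; norm_num
  rw [h4n] at hsn
  have hJ1 : 4 ^ Nat.log 4 s ≤ s := Nat.pow_log_le_self 4 (by omega)
  have hJ2 : s < 4 ^ (Nat.log 4 s + 1) := Nat.lt_pow_succ_log_self (by norm_num) s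
  -- The largest level count whose `4^J` coarse coefficients fit into a head of size `s`.
  set J := Nat.log 4 s with hJ
  have hJn : J ≤ n := by
    refine (Nat.pow_le_pow_iff_right (a := 4) (by norm_num)).1 ?_
    omega
  obtain ⟨S, hSc, hS⟩ := exists_coarse_set hJn
  refine ⟨S, hSc.trans hJ1, fun X => (hS X).trans ?_⟩
  have htv : 0 ≤ tv X := l1norm_nonneg _
  refine mul_le_mul_of_nonneg_right ?_ htv
  have hs0 : (0 : ℝ) < s := by exact_mod_cast hs
  have e4 : ((2 : ℝ) ^ n) ^ 2 = 4 ^ n := by exact_mod_cast h4n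
  rw [e4]
  have hl2 : Real.log 2 ≤ Real.log ((4 : ℝ) ^ n / s) := by
    refine Real.log_le_log (by norm_num) ?_
    rw [le_div_iff₀ hs0]
    exact_mod_cast hsn
  have hl4 : Real.log 4 = 2 * Real.log 2 := by
    rw [show (4 : ℝ) = 2 ^ 2 by norm_num, Real.log_pow]
    norm_num
  -- Rounding `log₄ s` down costs one extra `log 4 = 2 log 2`, at most `2 log (N²/s)` because `2s ≤
  -- N²`. So `n - J ≤ 3 log (N²/s)`, and the three wavelet types give `9`.
  have hl : ((n - J : ℕ) : ℝ) * Real.log 4 ≤ Real.log ((4 : ℝ) ^ n / s) + Real.log 4 := by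
    have h1 : Real.log s ≤ ((J : ℝ) + 1) * Real.log 4 := by
      have h := Real.log_le_log hs0 (y := 4 ^ (J + 1)) (by exact_mod_cast hJ2.le)
      rw [Real.log_pow] at h
      exact_mod_cast h
    rw [Real.log_div (by positivity) hs0.ne', Real.log_pow, Nat.cast_sub hJn]
    linarith
  have hlog2 := Real.log_two_gt_d9
  have h5 : ((n - J : ℕ) : ℝ) ≤ ((n - J : ℕ) : ℝ) * Real.log 4 :=
    le_mul_of_one_le_right (Nat.cast_nonneg _) (by linarith)
  linarith

end HaarLevels

/-! ### From total variation to the `ℓ₂` norm -/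

/-- Sobolev type inequality for images with small measurements. -/
theorem l2norm_le_log_mul_tv {n s m : ℕ} {δ : ℝ} (hs : 1 ≤ s) (hsn : 2 * s ≤ (2 ^ n) ^ 2)
    {B : Img (2 ^ n) (2 ^ n) →ₗ[ℂ] (Fin m → ℂ)}
    (hB : HasRIP (2 * s) δ (B ∘ₗ ((haarTransform n).symm :
      (HaarIndex n → ℂ) →ₗ[ℂ] Img (2 ^ n) (2 ^ n)))) (X : Img (2 ^ n) (2 ^ n)) :
    l2norm X ≤ (l2norm (B X) + 2 * (9 * Real.log (((2 : ℝ) ^ n) ^ 2 / s) * (tv X / √s))) /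
      √(1 - δ) + 9 * Real.log (((2 : ℝ) ^ n) ^ 2 / s) * (tv X / √s) := by
  obtain ⟨S, hSc, hS⟩ := exists_haar_head hs hsn
  -- The order `2s` is spent on the `s` coarse coefficients and one block of `s` further ones.
  obtain ⟨W, -, hW1, hW2⟩ := hB.exists_head (t := s) (by omega) (by ring) (haarLin n X) hSc
  have hκ : 0 < √(1 - δ) := Real.sqrt_pos.2 (by linarith [hB.2.1])
  have hκ2 : √(1 + δ) ≤ 2 := Real.sqrt_le_iff.2 ⟨by norm_num, by linarith [hB.2.1]⟩
  have hT : (B ∘ₗ ((haarTransform n).symm : (HaarIndex n → ℂ) →ₗ[ℂ] Img (2 ^ n) (2 ^ n)))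
      (haarLin n X) = B X :=
    congrArg B ((haarTransform n).symm_apply_apply X)
  rw [hT] at hW2
  set R := (∑ i ∈ Sᶜ, ‖haarLin n X i‖) / √(s : ℝ) with hR
  have hR0 : 0 ≤ R := div_nonneg (Finset.sum_nonneg fun _ _ => norm_nonneg _) (Real.sqrt_nonneg _)
  have hRle : R ≤ 9 * Real.log (((2 : ℝ) ^ n) ^ 2 / s) * (tv X / √s) := by
    rw [← mul_div_assoc]
    exact div_le_div_of_nonneg_right (hS X) (Real.sqrt_nonneg _)
  have h1 := l2norm_le_head_add_tail W (haarLin n X)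
  rw [l2norm_haarLin] at h1
  refine h1.trans (add_le_add ?_ (hW1.trans hRle))
  rw [le_div_iff₀ hκ, mul_comm]
  refine hW2.trans ?_
  have : √(1 + δ) * R ≤ 2 * R := by gcongr
  linarith

end TVRecovery

/-! ### The recovery theorem -/

theorem theorem2 :
    ∃ C₀ : ℝ, 0 < C₀ ∧ ∀ δB : ℝ, 0 < δB → δB < 1 → ∃ C₁ : ℝ, 0 < C₁ ∧
      ∀ (n s m₁ m₂ : ℕ) (δA : ℝ), 1 ≤ s → δA < 1 / 3 →
      ∀ (A A' : Img (2 ^ n - 1) (2 ^ n) →ₗ[ℂ] (Fin m₁ → ℂ))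
        (B : Img (2 ^ n) (2 ^ n) →ₗ[ℂ] (Fin m₂ → ℂ)),
      HasRIP (5 * s) δA (concat A A') →
      HasRIP (2 * s) δB
        (B ∘ₗ ((haarTransform n).symm :
          (HaarIndex n → ℂ) →ₗ[ℂ] Img (2 ^ n) (2 ^ n))) →
      ∀ (X : Img (2 ^ n) (2 ^ n))
        (ξ y : Fin m₁ ⊕ Fin m₁ ⊕ Fin m₁ ⊕ Fin m₁ ⊕ Fin m₂ → ℂ) (ε : ℝ),
      y = measurement A A' B X + ξ → l2norm ξ ≤ ε →
      ∀ (G : Fin (2 ^ n) × Fin (2 ^ n) × Fin 2 → ℂ),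
      IsLargestPart s (grad X) G →
      ∀ (Xhat : Img (2 ^ n) (2 ^ n)),
      IsTVMinimizer (measurement A A' B) y ε Xhat →
        l2norm (grad X - grad Xhat) ≤
            C₀ * (l1norm (grad X - G) / Real.sqrt s + ε) ∧
        tv (X - Xhat) ≤
            C₀ * (l1norm (grad X - G) + Real.sqrt s * ε) ∧
        (2 * s ≤ (2 ^ n) ^ 2 →
          l2norm (X - Xhat) ≤
            C₁ * (Real.log (((2 : ℝ) ^ n) ^ 2 / s) *
              (l1norm (grad X - G) / Real.sqrt s + ε))) := by
  refine ⟨42, by norm_num, fun δB _ hδB1 => ?_⟩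
  have hκ : 0 < √(1 - δB) := Real.sqrt_pos.2 (by linarith)
  -- `378 = 9 * 42` bounds the tail; `760 = 4 + 2 * 378` collects the measurement term and the image
  -- of the tail.
  refine ⟨760 / √(1 - δB) + 378, by positivity, ?_⟩
  intro n s m₁ m₂ δA hs hδA A A' B hA hB X ξ y ε hy hξ G hG Xhat hmin
  obtain ⟨hfeas, hopt⟩ := hmin
  have hX : l2norm (measurement A A' B X - y) ≤ ε := by
    rw [hy, l2norm_sub_comm, add_sub_cancel_left]
    exact hξ
  have htv : tv Xhat ≤ tv X := hopt hX
  have hM : l2norm (measurement A A' B (X - Xhat)) ≤ 2 * ε := by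
    rw [measurement_sub, ← sub_sub_sub_cancel_right _ _ y]
    refine (l2norm_sub_le _ _).trans ?_
    have : l2norm (measurement A A' B Xhat - y) ≤ ε := hfeas
    linarith
  obtain ⟨h1, h2⟩ := gradient_recovery hs hδA B hA htv hM hG
  refine ⟨h1, h2, fun hsn => ?_⟩
  have hs0 : (0 : ℝ) < s := by exact_mod_cast hs
  have hr : 0 < √(s : ℝ) := Real.sqrt_pos.2 hs0
  have hε : 0 ≤ ε := (l2norm_nonneg _).trans hξ
  set u := l1norm (grad X - G) / √(s : ℝ) + ε with hu
  have hεu : ε ≤ u := le_add_of_nonneg_left (div_nonneg (l1norm_nonneg _) hr.le)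
  -- This lower bound, from `2s ≤ N²`, absorbs the noise term without a logarithm: `2ε ≤ 4 ℓ u`.
  have hl : 1 / 2 ≤ Real.log (((2 : ℝ) ^ n) ^ 2 / s) := by
    have h : Real.log 2 ≤ Real.log (((2 : ℝ) ^ n) ^ 2 / s) := by
      refine Real.log_le_log (by norm_num) ?_
      rw [le_div_iff₀ hs0]
      exact_mod_cast hsn
    have := Real.log_two_gt_d9
    linarith
  set ℓ := Real.log (((2 : ℝ) ^ n) ^ 2 / s) with hℓ
  have htvu : tv (X - Xhat) / √(s : ℝ) ≤ 42 * u := by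
    rw [div_le_iff₀ hr, hu, mul_assoc, add_mul, div_mul_cancel₀ _ hr.ne', mul_comm ε]
    exact h2
  have hlt : 9 * ℓ * (tv (X - Xhat) / √(s : ℝ)) ≤ 378 * (ℓ * u) := by
    have : 9 * ℓ * (tv (X - Xhat) / √(s : ℝ)) ≤ 9 * ℓ * (42 * u) := by gcongr
    linarith
  have hB' : l2norm (B (X - Xhat)) ≤ 4 * (ℓ * u) := by
    have := (l2norm_map_le_measurement A A' B (X - Xhat)).trans hM
    nlinarith
  refine (l2norm_le_log_mul_tv hs hsn hB (X - Xhat)).trans ?_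
  rw [add_mul, div_mul_eq_mul_div]
  refine add_le_add ?_ hlt
  gcongr
  linarith
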